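/- **Definitions.** A *generator-bounded space* $\mathcal F_e$ is a separable complex Banach space of functions $g:\mathbb R\to\mathbb C$ on which every point evaluation $g\mapsto g(t)$ is continuous, such that 1. for all $\tau\ge 0$ and $g\in\mathcal F_e$, the shifted signal $U^\tau g=g(\cdot+\tau)$ is in $\mathcal F_e$ (the Koopman operators $U^\tau|_{\mathcal F_e}$); 2. the generator $L|_{\mathcal F_e}g=\lim_{\tau\to0^+}\frac1\tau(U^\tau g-g)$ (limit in norm) is defined on all of $\mathcal F_e$ and is a bounded operator. Write $\mu(\mathcal F_e)=\max|\mathrm{Im}\,\sigma(L|_{\mathcal F_e})|$, where $\sigma$ denotes the spectrum and $\mu(\{0\})=0$. For a signal $g$ belonging to some generator-bounded space put $\mu(g)=\min\mu(\mathcal F_e)$, the minimum being over all generator-bounded spaces $\mathcal F_e$ containing $g$. For a sampling period $T_s>0$, an *alias* of $g$ is a signal $\hat g\ne g$ belonging to some generator-bounded space such that $\hat g(kT_s)=g(kT_s)$ for all $k\in\mathbb Z$ and $\mu(\hat g)\le\mu(g)$; $g$ is *sampled without aliasing* if it has no alias. A *principal logarithm* of a bounded operator $Y$ is a bounded operator $B$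 with $\exp B=Y$ and $\sigma(B)\subset\{z:-\pi<\mathrm{Im}\,z<\pi\}$. **Theorem.** Let $g$ be a signal belonging to a generator-bounded space, let $T_s>0$ and $\omega_s=2\pi/T_s$. Then: (a) the minimum $\mu(g)$ exists (it is attained by some generator-bounded space containing $g$); (b) $g$ is sampled without aliasing if and only if $$\omega_s>2\mu(g)=2\min_{\mathcal F_e\ni g}\max|\mathrm{Im}\,\sigma(L|_{\mathcal F_e})|;$$ moreover, if $\omega_s\le 2\mu(g)$, then there is an alias $\hat g$ of $g$ with $\mu(\hat g)\le\omega_s/2$; (c) for every generator-bounded space $\mathcal F_e$ containing $g$, the operator $T_sL|_{\mathcal F_e}$ is a principal logarithm of $U^{T_s}|_{\mathcal F_e}$ if and only if $\omega_s>2\mu(\mathcal F_e)$. In that case (in particular, if $\omega_s>2\mu(g)$, for every $\mathcal F_e$ attaining the minimum) $U^{T_s}|_{\mathcal F_e}$ has exactly one principal logarithm $\mathrm{Log}(U^{T_s}|_{\mathcal F_e})$, it equals $T_sL|_{\mathcal F_e}$, and for all $\tau\in\mathbb R$ $$g(\tau)=\Big(\exp\Big(\tfrac{\tau}{T_s}\,\mathrm{Log}(U^{T_s}|_{\mathcal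 F_e})\Big)g\Big)(0).$$ -/

import Mathlib

open Filter Topology
open scoped NNReal

/-- A separable complex Banach space of signals `ℝ → ℂ`: a separable Banach space `E`, each vector
`f` of which is (via the linear injection `sig`) a function `sig f : ℝ → ℂ`, the value of a signal
at each fixed time being continuous in the norm. As `E` embeds in `ℝ → ℂ`, taking `E : Type`
loses no generality. -/
structure SignalSpace where
  E : Type
  [normedAddCommGroup : NormedAddCommGroup E]
  [normedSpace : NormedSpace ℂ E]
  [completeSpace : CompleteSpace E]
  [separableSpace : TopologicalSpace.SeparableSpace E]
  sig : E →ₗ[ℂ] (ℝ → ℂ)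
  sig_injective : Function.Injective sig
  continuous_eval : ∀ t : ℝ, Continuous fun f : E => sig f t

attribute [instance] SignalSpace.normedAddCommGroup SignalSpace.normedSpace
  SignalSpace.completeSpace SignalSpace.separableSpace

/-- A Banach space of signals that is invariant under `g ↦ g (· + τ)` for all `τ ≥ 0`. -/
structure ShiftInvariantSpace extends SignalSpace where
  shift_mem : ∀ (τ : ℝ≥0) (f : E), ∃ h : E, ∀ t : ℝ, sig h t = sig f (t + τ)

namespace ShiftInvariantSpace

variable (F : ShiftInvariantSpace)

/-- The Koopman operator `U^τ g = g (· + τ)` as a linear map of the space to itself. -/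
noncomputable def koopmanLinear (τ : ℝ≥0) : F.E →ₗ[ℂ] F.E where
  toFun f := (F.shift_mem τ f).choose
  map_add' f h := F.sig_injective <| funext fun t => by
    rw [(F.shift_mem τ (f + h)).choose_spec t, map_add, map_add, Pi.add_apply, Pi.add_apply,
      (F.shift_mem τ f).choose_spec t, (F.shift_mem τ h).choose_spec t]
  map_smul' c f := F.sig_injective <| funext fun t => by
    rw [(F.shift_mem τ (c • f)).choose_spec t, map_smul, RingHom.id_apply, map_smul,
      Pi.smul_apply, Pi.smul_apply, (F.shift_mem τ f).choose_spec t]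

theorem sig_koopmanLinear (τ : ℝ≥0) (f : F.E) (t : ℝ) :
    F.sig (F.koopmanLinear τ f) t = F.sig f (t + τ) :=
  (F.shift_mem τ f).choose_spec t

/-- The Koopman operator is automatically bounded, by the closed graph theorem. -/
theorem continuous_koopmanLinear (τ : ℝ≥0) : Continuous (F.koopmanLinear τ) := by
  refine (F.koopmanLinear τ).continuous_of_seq_closed_graph fun u x y hu hy => ?_
  refine F.sig_injective (funext fun t => ?_)
  have h1 := ((F.continuous_eval t).tendsto y).comp hy
  have h2 := ((F.continuous_eval (t + τ)).tendsto x).comp hu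
  rw [sig_koopmanLinear]
  refine tendsto_nhds_unique h1 (h2.congr fun n => ?_)
  exact (F.sig_koopmanLinear τ (u n) t).symm

/-- The Koopman operator `U^τ g = g (· + τ)` as a bounded operator. -/
noncomputable def koopman (τ : ℝ≥0) : F.E →L[ℂ] F.E :=
  ⟨F.koopmanLinear τ, F.continuous_koopmanLinear τ⟩

end ShiftInvariantSpace

/-- A generator-bounded space: the limit `L g = lim_{τ → 0⁺} τ⁻¹ (U^τ g - g)` exists in norm for
every `g` in the space and defines a bounded operator `L`. -/
structure GeneratorBoundedSpace extends ShiftInvariantSpace where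
  exists_generator : ∃ L : E →L[ℂ] E, ∀ f : E,
    Tendsto (fun τ : ℝ≥0 => ((τ : ℝ) : ℂ)⁻¹ • (toShiftInvariantSpace.koopman τ f - f))
      (𝓝[>] 0) (𝓝 (L f))

namespace GeneratorBoundedSpace

variable (F : GeneratorBoundedSpace)

/-- The Koopman operator `U^τ` on the space. -/
noncomputable abbrev U (τ : ℝ≥0) : F.E →L[ℂ] F.E := F.toShiftInvariantSpace.koopman τ

/-- The (unique) generator `L` of the Koopman semigroup on the space. -/
noncomputable def L : F.E →L[ℂ] F.E := F.exists_generator.choose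

/-- `max |Im σ(L)|` (a maximum because the spectrum is compact; `0` for the zero space). -/
noncomputable def maxIm : ℝ := sSup ((fun z : ℂ => |z.im|) '' spectrum ℂ F.L)

end GeneratorBoundedSpace

/-- The signal `g` belongs to the space `F`. -/
def GeneratorBoundedSpace.Contains (F : GeneratorBoundedSpace) (g : ℝ → ℂ) : Prop :=
  ∃ f : F.E, F.sig f = g

/-- The values `max |Im σ(L|_F)|` over all generator-bounded spaces `F` containing `g`. -/
def freqSet (g : ℝ → ℂ) : Set ℝ :=
  {r | ∃ F : GeneratorBoundedSpace, F.Contains g ∧ r = F.maxIm}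

/-- `min_F max |Im σ(L|_F)|` over the generator-bounded spaces `F` containing `g`. -/
noncomputable def minFreq (g : ℝ → ℂ) : ℝ := sInf (freqSet g)

/-- `g'` is an alias of `g` for the sampling period `Ts`: another signal of some generator-bounded
space, with the same samples as `g`, which does not oscillate faster than `g`. -/
def IsAlias (Ts : ℝ) (g g' : ℝ → ℂ) : Prop :=
  g' ≠ g ∧ (∃ F : GeneratorBoundedSpace, F.Contains g') ∧
    (∀ k : ℤ, g' (k * Ts) = g (k * Ts)) ∧ minFreq g' ≤ minFreq g

/-- There is no aliasing of `g` at the sampling period `Ts`. -/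
def NoAliasing (Ts : ℝ) (g : ℝ → ℂ) : Prop := ∀ g' : ℝ → ℂ, ¬ IsAlias Ts g g'

/-- `B` is a principal logarithm of the bounded operator `Y`: `exp B = Y` and the spectrum of `B`
lies in the open strip `|Im z| < π`. -/
def IsPrincipalLog {E : Type*} [NormedAddCommGroup E] [NormedSpace ℂ E] (Y B : E →L[ℂ] E) : Prop :=
  NormedSpace.exp B = Y ∧ spectrum ℂ B ⊆ {z : ℂ | -Real.pi < z.im ∧ z.im < Real.pi}

open Classical in
/-- The principal logarithm of `Y`, if there is one (else `0`). -/
noncomputable def principalLog {E : Type*} [NormedAddCommGroup E] [NormedSpace ℂ E]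
    (Y : E →L[ℂ] E) : E →L[ℂ] E :=
  if h : ∃ B, IsPrincipalLog Y B then h.choose else 0

/-! On a generator-bounded space the Koopman semigroup is `exp (τ L)`, so a signal is `t ↦ φ (exp (t
L) f)` with `φ` the evaluation at `0`, and it extends to an entire function of exponential type.

The minimum is attained because frequencies can be read from growth. A space with `maxIm < c` forces
growth `O(exp (c |y|))` of the extension on the imaginary axis, and the extension depends on the
signal alone, so it obeys this bound for every `c > minFreq g`. Conversely,
`exists_generatorBoundedSpace_of_growth` turns all these bounds together into one space: the
derivatives on the imaginary axis are recorded in a weighted supremum norm, and one passes to a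
closed orbit span modulo its unobservable states.

Sampling above the bound is injective because a logarithm `b` with spectrum in `|Im z| < π` is an
integral of resolvents of `exp b` along the segment from `1` to `exp b`. Hence `b` is unique, and
closed subspaces invariant under `exp b` are invariant under `b` (`mapsTo_of_mapsTo_exp`). Applied
to two signals in a product space, this shows that a difference vanishing at the samples vanishes at
all times (`eq_of_forall_sample_eq`).

Below the bound, Cauchy's formula writes the signal as a superposition of exponentials with
exponents on a circle. Translating each exponent by a multiple of `iω_s` into `|Im z| ≤ ω_s / 2`
keeps the samples, and a multiple of `sin (π t / T_s)` can be added to make the result differ from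
the signal (`exists_ne_sample_eq`). -/

/-! ### Exponentials in a complex Banach algebra. -/

section BanachAlgebra

variable {A : Type*} [NormedRing A] [NormedAlgebra ℂ A] [CompleteSpace A]

theorem exp_add_of_commute_complex {x y : A} (h : Commute x y) :
    NormedSpace.exp (x + y) = NormedSpace.exp x * NormedSpace.exp y := by
  let _ := NormedAlgebra.restrictScalars ℚ ℂ A
  exact NormedSpace.exp_add_of_commute h

theorem exp_add_smul (x : A) (s t : ℂ) :
    NormedSpace.exp ((s + t) • x) = NormedSpace.exp (s • x) * NormedSpace.exp (t • x) := by
  rw [add_smul, exp_add_of_commute_complex (((Commute.refl x).smul_left s).smul_right t)]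

theorem exp_nsmul_complex (n : ℕ) (x : A) :
    NormedSpace.exp ((n : ℂ) • x) = NormedSpace.exp x ^ n := by
  let _ := NormedAlgebra.restrictScalars ℚ ℂ A
  rw [← NormedSpace.exp_nsmul, Nat.cast_smul_eq_nsmul]

theorem map_exp_complex {B : Type*} [NormedRing B] [NormedAlgebra ℂ B] (f : A →ₐ[ℂ] B)
    (hf : Continuous f) (x : A) : f (NormedSpace.exp x) = NormedSpace.exp (f x) := by
  let _ := NormedAlgebra.restrictScalars ℚ ℂ A
  let _ := NormedAlgebra.restrictScalars ℚ ℂ B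
  exact NormedSpace.map_exp f hf x

theorem continuous_exp_complex : Continuous (NormedSpace.exp : A → A) := by
  let _ := NormedAlgebra.restrictScalars ℚ ℂ A
  exact NormedSpace.exp_continuous

theorem continuous_exp_smul (x : A) : Continuous fun s : ℂ => NormedSpace.exp (s • x) :=
  continuous_exp_complex.comp (by fun_prop)

end BanachAlgebra

/-! ### Principal logarithms in a commutative Banach algebra, by Gelfand theory. -/

section CommutativeBanachAlgebra

open WeakDual

variable {B : Type*} [NormedCommRing B] [NormedAlgebra ℂ B]

theorem character_inverse (χ : characterSpace ℂ B) {x : B} (hx : IsUnit x) :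
    χ (Ring.inverse x) = (χ x)⁻¹ := by
  obtain ⟨u, rfl⟩ := hx
  rw [Ring.inverse_unit]
  refine eq_inv_of_mul_eq_one_left ?_
  rw [← map_mul, Units.inv_mul, map_one]

variable [CompleteSpace B]

theorem character_exp (χ : characterSpace ℂ B) (x : B) :
    χ (NormedSpace.exp x) = Complex.exp (χ x) := by
  rw [Complex.exp_eq_exp_ℂ]
  exact map_exp_complex (CharacterSpace.toAlgHom χ) (CharacterSpace.toCLM χ).continuous x

theorem isUnit_of_character_ne_zero {x : B} (h : ∀ χ : characterSpace ℂ B, χ x ≠ 0) :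
    IsUnit x := by
  by_contra hx
  obtain ⟨χ, hχ⟩ := CharacterSpace.exists_apply_eq_zero hx
  exact h χ hχ

/-- If no nonzero multiple of `2πi` is in the spectrum of `a`, then `exp a - 1` is a unit multiple
of `a`. -/
theorem exists_isUnit_mul_eq_exp_sub_one {a : B}
    (h : ∀ χ : characterSpace ℂ B, Complex.exp (χ a) = 1 → χ a = 0) :
    ∃ u : B, IsUnit u ∧ a * u = NormedSpace.exp a - 1 := by
  have hcont : Continuous fun s : ℝ => NormedSpace.exp (s • a) :=
    continuous_exp_complex.comp (by fun_prop)
  have hmul : a * (∫ s in (0 : ℝ)..1, NormedSpace.exp (s • a)) = NormedSpace.exp a - 1 := by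
    have h1 := intervalIntegral.integral_eq_sub_of_hasDerivAt
      (fun s _ => hasDerivAt_exp_smul_const' (𝕂 := ℝ) a s)
      ((continuous_const.mul hcont).intervalIntegrable 0 1)
    rw [one_smul, zero_smul, NormedSpace.exp_zero] at h1
    rw [← h1]
    exact ((ContinuousLinearMap.mul ℂ B a).intervalIntegral_comp_comm
      (hcont.intervalIntegrable 0 1)).symm
  -- If `χ` kills the integral, then `exp (χ a) = 1`, so `χ a = 0`; but then `χ` maps the integral
  -- to `∫ 1 = 1`.
  refine ⟨_, isUnit_of_character_ne_zero fun χ hχ => ?_, hmul⟩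
  have h2 := congrArg χ hmul
  rw [map_mul, hχ, mul_zero, map_sub, map_one, character_exp] at h2
  have h3 : χ a = 0 := h χ (sub_eq_zero.1 h2.symm)
  have h4 := (CharacterSpace.toCLM χ).intervalIntegral_comp_comm
    (hcont.intervalIntegrable (μ := MeasureTheory.volume) 0 1)
  simp only [CharacterSpace.coe_toCLM] at h4
  rw [hχ] at h4
  have h5 : ∀ s : ℝ, χ (NormedSpace.exp (s • a)) = 1 := fun s => by
    rw [character_exp, ← Complex.coe_smul, map_smul, h3, smul_zero, Complex.exp_zero]
  simp [h5] at h4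

/-- This stands in for semisimplicity: elements with equal characters may differ by a quasinilpotent
`a`, but `exp a - 1` is `a` times a unit, so `exp a = 1` rules out `a ≠ 0`. -/
theorem eq_zero_of_exp_eq_one {a : B} (h : ∀ χ : characterSpace ℂ B, χ a = 0)
    (ha : NormedSpace.exp a = 1) : a = 0 := by
  obtain ⟨u, hu, hmul⟩ := exists_isUnit_mul_eq_exp_sub_one (a := a) fun χ _ => h χ
  rw [ha, sub_self] at hmul
  exact hu.mul_left_eq_zero.1 hmul

/-- The segment from `1` to `y` is bounded away from `0` if `y` is not a negative number. -/
theorem one_add_mul_sub_one_mem_slitPlane {y : ℂ} (hy : y ∈ Complex.slitPlane) {s : ℝ}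
    (hs : s ∈ Set.Icc (0 : ℝ) 1) : 1 + (s : ℂ) * (y - 1) ∈ Complex.slitPlane := by
  have h := Complex.starConvex_one_slitPlane hy (sub_nonneg.2 hs.2) hs.1 (by ring)
  convert h using 1
  simp only [Complex.real_smul]
  push_cast
  ring

/-- The integrand is the derivative of `log` along the segment from `1` to `y`, which avoids the
cut. -/
theorem integral_log_formula {y : ℂ} (hy : y ∈ Complex.slitPlane) :
    ∫ s in (0 : ℝ)..1, (y - 1) * (1 + (s : ℂ) * (y - 1))⁻¹ = Complex.log y := by
  have h1 : ∀ s ∈ Set.uIcc (0 : ℝ) 1, HasDerivAt (fun s : ℝ => Complex.log (1 + (s : ℂ) * (y - 1)))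
      ((y - 1) * (1 + (s : ℂ) * (y - 1))⁻¹) s := fun s hs => by
    rw [Set.uIcc_of_le zero_le_one] at hs
    have h2 : HasDerivAt (fun s : ℝ => 1 + (s : ℂ) * (y - 1)) (y - 1) s := by
      simpa using ((Complex.ofRealCLM.hasDerivAt (x := s)).mul_const (y - 1)).const_add 1
    simpa [div_eq_mul_inv] using h2.clog_real (one_add_mul_sub_one_mem_slitPlane hy hs)
  rw [intervalIntegral.integral_eq_sub_of_hasDerivAt h1]
  · simp
  · refine ContinuousOn.intervalIntegrable fun s hs => ContinuousAt.continuousWithinAt ?_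
    rw [Set.uIcc_of_le zero_le_one] at hs
    refine continuousAt_const.mul (ContinuousAt.inv₀ (by fun_prop) ?_)
    exact Complex.slitPlane_ne_zero (one_add_mul_sub_one_mem_slitPlane hy hs)

variable {b : B}

theorem exp_mem_slitPlane {z : ℂ} (h : |z.im| < Real.pi) : Complex.exp z ∈ Complex.slitPlane := by
  rw [abs_lt] at h
  rw [Complex.mem_slitPlane_iff_arg]
  refine ⟨fun h1 => ?_, Complex.exp_ne_zero z⟩
  rw [Complex.arg_exp, toIocMod_eq_self _ |>.2] at h1
  · exact h.2.ne h1
  · constructor <;> linarith [h.1, h.2]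

theorem isUnit_one_add_smul_exp_sub_one (hb : ∀ χ : characterSpace ℂ B, |(χ b).im| < Real.pi)
    {s : ℝ} (hs : s ∈ Set.Icc (0 : ℝ) 1) :
    IsUnit (1 + s • (NormedSpace.exp b - 1)) := by
  refine isUnit_of_character_ne_zero fun χ => ?_
  rw [map_add, map_one, ← Complex.coe_smul, map_smul, map_sub, map_one, character_exp, smul_eq_mul]
  exact Complex.slitPlane_ne_zero
    (one_add_mul_sub_one_mem_slitPlane (exp_mem_slitPlane (hb χ)) hs)

/-- The logarithm with spectrum in the open strip `|Im z| < π` is given by an integral of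
resolvents. -/
theorem eq_integral_of_abs_character_im_lt (hb : ∀ χ : characterSpace ℂ B, |(χ b).im| < Real.pi) :
    b = ∫ s in (0 : ℝ)..1, (NormedSpace.exp b - 1) *
      Ring.inverse (1 + s • (NormedSpace.exp b - 1)) := by
  set w := NormedSpace.exp b - 1 with hw
  let p : ℝ → B := fun s => 1 + s • w
  let q : ℝ → B := fun s => w * Ring.inverse (p s)
  have hp : Continuous p := by fun_prop
  have hpu : ∀ s ∈ Set.Icc (0 : ℝ) 1, IsUnit (p s) := fun s hs =>
    isUnit_one_add_smul_exp_sub_one hb hs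
  have hqc : ∀ s, IsUnit (p s) → ContinuousAt q s := fun s ⟨u, hu⟩ => by
    refine continuousAt_const.mul (ContinuousAt.comp' (g := Ring.inverse) ?_ hp.continuousAt)
    rw [← hu]
    exact NormedRing.inverse_continuousAt u
  have hqcon : ContinuousOn q (Set.Icc 0 1) := fun s hs =>
    (hqc s (hpu s hs)).continuousWithinAt
  have hqi : IntervalIntegrable q MeasureTheory.volume 0 1 :=
    ContinuousOn.intervalIntegrable (by rwa [Set.uIcc_of_le zero_le_one])
  set ℓ : ℝ → B := fun s => ∫ t in (0 : ℝ)..s, q t with hℓ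
  -- A character passes through the integral and reduces it to the scalar formula, with value `log
  -- (exp (χ b))`; this is `χ b` because `|Im (χ b)| < π`.
  have hchar : ∀ χ : characterSpace ℂ B, χ (ℓ 1) = χ b := fun χ => by
    have h1 := (CharacterSpace.toCLM χ).intervalIntegral_comp_comm hqi
    simp only [CharacterSpace.coe_toCLM] at h1
    rw [← h1]
    have hs := exp_mem_slitPlane (hb χ)
    rw [← Complex.log_exp (abs_lt.1 (hb χ)).1 (abs_lt.1 (hb χ)).2.le, ← integral_log_formula hs]
    refine intervalIntegral.integral_congr fun s hs => ?_
    rw [Set.uIcc_of_le zero_le_one] at hs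
    change χ (w * Ring.inverse (p s)) = _
    rw [map_mul, character_inverse χ (hpu s hs), hw, map_sub, map_one, character_exp, map_add,
      map_one, ← Complex.coe_smul, map_smul, smul_eq_mul, hw, map_sub, map_one, character_exp]
  have hℓd : ∀ s ∈ Set.Icc (0 : ℝ) 1, HasDerivWithinAt ℓ (q s) (Set.Icc 0 1) s := fun s hs => by
    have : Fact (s ∈ Set.Icc (0 : ℝ) 1) := ⟨hs⟩
    refine intervalIntegral.integral_hasDerivWithinAt_right ?_ ?_ (hqcon s hs)
    · refine ContinuousOn.intervalIntegrable (hqcon.mono ?_)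
      rw [Set.uIcc_of_le hs.1]
      exact Set.Icc_subset_Icc_right hs.2
    · exact hqcon.stronglyMeasurableAtFilter_nhdsWithin measurableSet_Icc s
  -- `ℓ s` is a logarithm of `p s`: the derivative of the product is `exp (-ℓ) (w - q p)`, and `q p
  -- = w`.
  have hexp : ∀ s ∈ Set.Icc (0 : ℝ) 1, NormedSpace.exp (-ℓ s) * p s = 1 := by
    have hd : ∀ s ∈ Set.Icc (0 : ℝ) 1,
        HasDerivWithinAt (fun s => NormedSpace.exp (-ℓ s) * p s) 0 (Set.Icc 0 1) s := fun s hs => by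
      have h1 : HasDerivWithinAt (fun s => NormedSpace.exp (-ℓ s))
          (NormedSpace.exp (-ℓ s) * (-q s)) (Set.Icc 0 1) s := by
        refine ((hasFDerivAt_exp (𝕂 := ℝ) (x := -ℓ s)).comp_hasDerivWithinAt s
          (hℓd s hs).neg).congr_deriv ?_
        simp
      have h2 : HasDerivWithinAt p w (Set.Icc 0 1) s := by
        refine (((hasDerivWithinAt_id s (Set.Icc 0 1)).smul_const w).const_add 1).congr_deriv ?_
        rw [one_smul]
      refine (h1.mul h2).congr_deriv ?_
      have h3 : q s * p s = w := by
        change w * Ring.inverse (p s) * p s = w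
        rw [mul_assoc, Ring.inverse_mul_cancel _ (hpu s hs), mul_one]
      rw [mul_assoc, neg_mul, h3]
      ring
    intro s hs
    have h0 : NormedSpace.exp (-ℓ 0) * p 0 = 1 := by simp [hℓ, p]
    rw [← h0]
    refine constant_of_derivWithin_zero (fun x hx => (hd x hx).differentiableWithinAt) ?_ s hs
    intro x hx
    exact (hd x (Set.Ico_subset_Icc_self hx)).derivWithin
      (uniqueDiffOn_Icc zero_lt_one x (Set.Ico_subset_Icc_self hx))
  have h1 := hexp 1 ⟨zero_le_one, le_rfl⟩
  have hp1 : p 1 = NormedSpace.exp b := by simp [p, hw]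
  rw [hp1, ← exp_add_of_commute_complex (Commute.all _ _)] at h1
  -- The element `-ℓ 1 + b` has exponential `1` and is killed by every character.
  have h2 := eq_zero_of_exp_eq_one (fun χ => by rw [map_add, map_neg, hchar, neg_add_cancel]) h1
  exact (neg_add_eq_zero.1 h2).symm

end CommutativeBanachAlgebra

/-! ### Passage to noncommutative algebras through the bicommutant. -/

section Bicommutant

open WeakDual

variable {A : Type*} [NormedRing A] [NormedAlgebra ℂ A]

/-- The bicommutant of an element: a closed, commutative, inverse-closed subalgebra. -/
def bicommutant (a : A) : Subalgebra ℂ A :=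
  Subalgebra.centralizer ℂ (Subalgebra.centralizer ℂ {a} : Set A)

theorem self_mem_bicommutant (a : A) : a ∈ bicommutant a :=
  Set.subset_centralizer_centralizer (Set.mem_singleton a)

theorem isClosed_bicommutant (a : A) : IsClosed (bicommutant a : Set A) :=
  Set.isClosed_centralizer _

instance (a : A) : NormedCommRing (bicommutant a) :=
  { (bicommutant a).normedRing with
    mul_comm := fun x y => Subtype.ext <|
      Set.centralizer_centralizer_comm_of_comm (S := {a}) (by simp) x x.2 y y.2 }

instance [CompleteSpace A] (a : A) : CompleteSpace (bicommutant a) :=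
  (isClosed_bicommutant a).completeSpace_coe

/-- An inverse commutes with everything that the element commutes with, so spectra do not change on
passing to the bicommutant. -/
theorem isUnit_bicommutant_iff {a : A} (x : bicommutant a) : IsUnit (x : A) ↔ IsUnit x := by
  refine ⟨fun ⟨u, hu⟩ => ?_, fun h => h.map (bicommutant a).val⟩
  have hmem : ((u⁻¹ : Aˣ) : A) ∈ bicommutant a := fun c hc =>
    (show Commute c (u : A) from hu ▸ x.2 c hc).units_inv_right
  refine isUnit_iff_exists_inv.2 ⟨⟨_, hmem⟩, Subtype.ext ?_⟩
  change (x : A) * ((u⁻¹ : Aˣ) : A) = 1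
  rw [← hu, Units.mul_inv]

theorem spectrum_bicommutant {a : A} (x : bicommutant a) :
    spectrum ℂ x = spectrum ℂ (x : A) := by
  ext z
  rw [spectrum.mem_iff, spectrum.mem_iff, not_iff_not, ← isUnit_bicommutant_iff]
  rfl

variable [CompleteSpace A]

theorem coe_exp_bicommutant {a : A} (x : bicommutant a) :
    ((NormedSpace.exp x : bicommutant a) : A) = NormedSpace.exp (x : A) :=
  map_exp_complex (bicommutant a).val continuous_subtype_val x

theorem character_mem_spectrum {a : A} (x : bicommutant a)
    (χ : characterSpace ℂ (bicommutant a)) : χ x ∈ spectrum ℂ (x : A) := by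
  rw [← spectrum_bicommutant]
  exact CharacterSpace.mem_spectrum_iff_exists.2 ⟨χ, rfl⟩

/-- The inclusion `σ(exp a) ⊆ exp σ(a)` of the spectral mapping theorem, read off from characters of
the bicommutant. -/
theorem exists_mem_spectrum_exp_eq {a : A} {z : ℂ} (hz : z ∈ spectrum ℂ (NormedSpace.exp a)) :
    ∃ w ∈ spectrum ℂ a, Complex.exp w = z := by
  let b : bicommutant a := ⟨a, self_mem_bicommutant a⟩
  rw [show a = (b : A) from rfl, ← coe_exp_bicommutant, ← spectrum_bicommutant,
    CharacterSpace.mem_spectrum_iff_exists] at hz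
  obtain ⟨χ, hχ⟩ := hz
  exact ⟨χ b, character_mem_spectrum b χ, by rw [← character_exp, hχ]⟩

theorem isUnit_one_add_smul_exp_sub_one_of_spectrum {b : A}
    (hb : ∀ z ∈ spectrum ℂ b, |z.im| < Real.pi) {s : ℝ} (hs : s ∈ Set.Icc (0 : ℝ) 1) :
    IsUnit (1 + s • (NormedSpace.exp b - 1)) := by
  let c : bicommutant b := ⟨b, self_mem_bicommutant b⟩
  have hc : ∀ χ : characterSpace ℂ (bicommutant b), |(χ c).im| < Real.pi := fun χ =>
    hb _ (character_mem_spectrum c χ)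
  have h := (isUnit_one_add_smul_exp_sub_one hc hs).map (bicommutant b).val
  have h2 : (bicommutant b).val (1 + s • (NormedSpace.exp c - 1)) =
      1 + s • (NormedSpace.exp b - 1) := by
    change (1 : A) + s • ((NormedSpace.exp c : bicommutant b) - 1 : A) = _
    rw [coe_exp_bicommutant]
  rwa [h2] at h

/-- A logarithm with spectrum in the open strip `|Im z| < π` is given by an integral of
resolvents of its exponential. -/
theorem eq_integral_of_abs_im_spectrum_lt {b : A} (hb : ∀ z ∈ spectrum ℂ b, |z.im| < Real.pi) :
    b = ∫ s in (0 : ℝ)..1, (NormedSpace.exp b - 1) *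
      Ring.inverse (1 + s • (NormedSpace.exp b - 1)) := by
  let c : bicommutant b := ⟨b, self_mem_bicommutant b⟩
  have hc : ∀ χ : characterSpace ℂ (bicommutant b), |(χ c).im| < Real.pi := fun χ =>
    hb _ (character_mem_spectrum c χ)
  have h := eq_integral_of_abs_character_im_lt hc
  have hcont : ContinuousOn (fun s : ℝ => (NormedSpace.exp c - 1) *
      Ring.inverse (1 + s • (NormedSpace.exp c - 1))) (Set.uIcc 0 1) := fun s hs => by
    rw [Set.uIcc_of_le zero_le_one] at hs
    obtain ⟨u, hu⟩ := isUnit_one_add_smul_exp_sub_one hc hs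
    refine (continuousAt_const.mul (ContinuousAt.comp' (g := Ring.inverse) ?_
      (by fun_prop))).continuousWithinAt
    rw [← hu]
    exact NormedRing.inverse_continuousAt u
  have : CompleteSpace (Subalgebra.toSubmodule (bicommutant b)) :=
    inferInstanceAs (CompleteSpace (bicommutant b))
  have h3 := (bicommutant b).toSubmodule.subtypeL.intervalIntegral_comp_comm
    (hcont.intervalIntegrable (μ := MeasureTheory.volume))
  refine (congrArg (Subtype.val) h).trans (h3.symm.trans ?_)
  refine intervalIntegral.integral_congr fun s hs => ?_
  rw [Set.uIcc_of_le zero_le_one] at hs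
  obtain ⟨u, hu⟩ := isUnit_one_add_smul_exp_sub_one hc hs
  have h4 : (1 : A) + s • (NormedSpace.exp b - 1) =
      (u.map (bicommutant b).val.toMonoidHom : Aˣ) := by
    change _ = ((u : bicommutant b) : A)
    rw [hu]
    change _ = (1 : A) + s • ((NormedSpace.exp c : bicommutant b) - 1 : A)
    rw [coe_exp_bicommutant]
  rw [h4, Ring.inverse_unit, ← hu, Ring.inverse_unit]
  change ((NormedSpace.exp c : bicommutant b) - 1 : A) * _ = _
  rw [coe_exp_bicommutant]
  rfl

/-- Each logarithm is the same explicit function of its exponential, so `b` and `c` need not be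
assumed to commute. -/
theorem eq_of_exp_eq_exp_of_abs_im_spectrum_lt {b c : A}
    (hb : ∀ z ∈ spectrum ℂ b, |z.im| < Real.pi) (hc : ∀ z ∈ spectrum ℂ c, |z.im| < Real.pi)
    (h : NormedSpace.exp b = NormedSpace.exp c) : b = c := by
  rw [eq_integral_of_abs_im_spectrum_lt hb, eq_integral_of_abs_im_spectrum_lt hc, h]

end Bicommutant

/-! ### Invariant subspaces of a principal logarithm. -/

section Strip

variable {E : Type*} [NormedAddCommGroup E] [NormedSpace ℂ E] [CompleteSpace E]

/-- A closed subspace that is invariant under `exp b`, where `b` has spectrum in the open strip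
`|Im z| < π`, is invariant under `b`. -/
theorem mapsTo_of_mapsTo_exp {b : E →L[ℂ] E} (hb : ∀ z ∈ spectrum ℂ b, |z.im| < Real.pi)
    {N : Submodule ℂ E} (hN : IsClosed (N : Set E)) (h : ∀ x ∈ N, NormedSpace.exp b x ∈ N) :
    ∀ x ∈ N, b x ∈ N := by
  let S : Subalgebra ℂ (E →L[ℂ] E) :=
    { carrier := {T | ∀ x ∈ N, T x ∈ N}
      mul_mem' := fun {T T'} hT hT' x hx => hT _ (hT' x hx)
      add_mem' := fun {T T'} hT hT' x hx => N.add_mem (hT x hx) (hT' x hx)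
      algebraMap_mem' := fun r x hx => by
        rw [Algebra.algebraMap_eq_smul_one]
        exact N.smul_mem r hx }
  have hS : IsClosed (S : Set (E →L[ℂ] E)) := by
    have : (S : Set (E →L[ℂ] E)) = ⋂ x ∈ N, (fun T : E →L[ℂ] E => T x) ⁻¹' (N : Set E) := by
      ext T
      simp only [Set.mem_iInter]
      rfl
    rw [this]
    exact isClosed_biInter fun x _ => hN.preimage (ContinuousLinearMap.apply ℂ E x).continuous
  have hSc : CompleteSpace S := hS.completeSpace_coe
  have hw : NormedSpace.exp b - 1 ∈ S := S.sub_mem h S.one_mem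
  set w := NormedSpace.exp b - 1 with hwdef
  have hunit : ∀ s ∈ Set.Icc (0 : ℝ) 1, IsUnit (1 + s • w) := fun s hs =>
    isUnit_one_add_smul_exp_sub_one_of_spectrum hb hs
  have hcont : ContinuousOn (fun s : ℝ => Ring.inverse (1 + s • w)) (Set.Icc 0 1) := fun s hs => by
    obtain ⟨u, hu⟩ := hunit s hs
    refine (ContinuousAt.comp' (g := Ring.inverse) ?_ (by fun_prop)).continuousWithinAt
    rw [← hu]
    exact NormedRing.inverse_continuousAt u
  have hpath : ∀ s : ℝ, 1 + s • w ∈ S := fun s =>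
    S.add_mem S.one_mem (by rw [← Complex.coe_smul]; exact S.smul_mem hw _)
  let p : ℝ → S := fun s => ⟨1 + s • w, hpath s⟩
  have hp : Continuous p := by
    refine Continuous.subtype_mk ?_ _
    fun_prop
  -- The inverse of an operator preserving `N` need not preserve `N`, so the resolvents are followed
  -- from `s = 0`. The good parameters form a closed set because inversion is continuous and `S` is
  -- closed, and they extend to the right because the units of the Banach algebra `S` are open.
  have key : Set.Icc (0 : ℝ) 1 ⊆ {s | Ring.inverse (1 + s • w) ∈ S} := by
    refine IsClosed.Icc_subset_of_forall_exists_gt ?_ ?_ ?_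
    · rw [Set.inter_comm]
      exact hcont.preimage_isClosed_of_isClosed isClosed_Icc hS
    · simp [S.one_mem]
    · rintro s ⟨hs, hs'⟩ t ht
      have hu := hunit s (Set.Ico_subset_Icc_self hs')
      have hps : IsUnit (p s) := by
        refine ⟨⟨p s, ⟨_, hs⟩, Subtype.ext ?_, Subtype.ext ?_⟩, rfl⟩
        · exact Ring.mul_inverse_cancel _ hu
        · exact Ring.inverse_mul_cancel _ hu
      have hopen : ∀ᶠ r in 𝓝 s, IsUnit (p r) :=
        hp.continuousAt.eventually (Units.isOpen.mem_nhds hps)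
      obtain ⟨r, hr, hr'⟩ := ((hopen.filter_mono nhdsWithin_le_nhds).and
        (Ioc_mem_nhdsGT (Set.mem_Ioi.1 ht))).exists
      refine ⟨r, ?_, hr'⟩
      obtain ⟨u, hu⟩ := hr
      have : (1 : E →L[ℂ] E) + r • w = (u.map S.val.toMonoidHom : (E →L[ℂ] E)ˣ) :=
        congrArg Subtype.val hu.symm
      rw [Set.mem_ofPred_eq, this, Ring.inverse_unit]
      exact ((u⁻¹ : Sˣ) : S).2
  have hint : IntervalIntegrable (fun s : ℝ => w * Ring.inverse (1 + s • w))
      MeasureTheory.volume 0 1 := by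
    refine ContinuousOn.intervalIntegrable ?_
    rw [Set.uIcc_of_le zero_le_one]
    exact continuousOn_const.mul hcont
  intro x hx
  rw [eq_integral_of_abs_im_spectrum_lt hb]
  have h1 := (ContinuousLinearMap.apply ℂ E x).intervalIntegral_comp_comm hint
  rw [ContinuousLinearMap.apply_apply] at h1
  rw [← h1, intervalIntegral.integral_of_le zero_le_one]
  have h2 : ∀ s : ℝ, s ∈ Set.Ioc (0 : ℝ) 1 → (w * Ring.inverse (1 + s • w)) x ∈ N := fun s hs =>
    S.mul_mem hw (key (Set.Ioc_subset_Icc_self hs)) x hx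
  -- The interval has length one, so the integral is an average of points of the closed convex set
  -- `N`.
  have : MeasureTheory.IsProbabilityMeasure (MeasureTheory.volume.restrict (Set.Ioc (0 : ℝ) 1)) :=
    ⟨by simp⟩
  refine (N.restrictScalars ℝ).convex.integral_mem hN ?_
    ((ContinuousLinearMap.apply ℂ E x).integrable_comp hint.1)
  exact (MeasureTheory.ae_restrict_iff' measurableSet_Ioc).2 (Eventually.of_forall h2)

end Strip

/-! ### The Koopman semigroup as the exponential of its generator. -/

theorem exp_add_smul_apply {E : Type*} [NormedAddCommGroup E] [NormedSpace ℂ E] [CompleteSpace E]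
    (A : E →L[ℂ] E) (s t : ℂ) (x : E) :
    NormedSpace.exp ((s + t) • A) x = NormedSpace.exp (s • A) (NormedSpace.exp (t • A) x) :=
  DFunLike.congr_fun (exp_add_smul A s t) x

namespace ShiftInvariantSpace

variable (F : ShiftInvariantSpace)

theorem sig_koopman (τ : ℝ≥0) (f : F.E) (t : ℝ) : F.sig (F.koopman τ f) t = F.sig f (t + τ) :=
  F.sig_koopmanLinear τ f t

theorem koopman_zero_apply (f : F.E) : F.koopman 0 f = f :=
  F.sig_injective <| funext fun t => by rw [sig_koopman, NNReal.coe_zero, add_zero]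

theorem koopman_add_apply (σ τ : ℝ≥0) (f : F.E) :
    F.koopman (σ + τ) f = F.koopman σ (F.koopman τ f) :=
  F.sig_injective <| funext fun t => by
    rw [sig_koopman, sig_koopman, sig_koopman, NNReal.coe_add, add_assoc]

/-- Evaluation of signals at time `0` as a bounded functional. -/
noncomputable def evalZero : F.E →L[ℂ] ℂ :=
  ⟨(LinearMap.proj 0).comp F.sig, F.continuous_eval 0⟩

theorem evalZero_apply (f : F.E) : F.evalZero f = F.sig f 0 := rfl

end ShiftInvariantSpace

namespace GeneratorBoundedSpace

variable (F : GeneratorBoundedSpace)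

theorem tendsto_L (f : F.E) :
    Tendsto (fun τ : ℝ≥0 => ((τ : ℝ) : ℂ)⁻¹ • (F.U τ f - f)) (𝓝[>] 0) (𝓝 (F.L f)) :=
  F.exists_generator.choose_spec f

/-- `U^τ f - f` is `τ` times a convergent difference quotient. -/
theorem tendsto_U_apply (f : F.E) : Tendsto (fun τ : ℝ≥0 => F.U τ f) (𝓝 0) (𝓝 f) := by
  have h0 : Tendsto (fun τ : ℝ≥0 => ((τ : ℝ) : ℂ)) (𝓝[>] 0) (𝓝 0) := by
    have : Continuous fun τ : ℝ≥0 => ((τ : ℝ) : ℂ) := by fun_prop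
    simpa using (this.tendsto 0).mono_left nhdsWithin_le_nhds
  have h1 := (h0.smul (F.tendsto_L f)).add_const f
  rw [zero_smul, zero_add] at h1
  have h2 : Tendsto (fun τ : ℝ≥0 => F.U τ f) (𝓝[>] 0) (𝓝 f) := by
    refine h1.congr' ?_
    filter_upwards [self_mem_nhdsWithin] with τ hτ
    have hτ' : ((τ : ℝ) : ℂ) ≠ 0 := by
      exact_mod_cast (ne_of_gt hτ)
    rw [smul_inv_smul₀ hτ', sub_add_cancel]
  have h3 : (𝓝 (0 : ℝ≥0)) = 𝓝[>] 0 ⊔ pure 0 := by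
    rw [sup_comm, ← nhdsNE_sup_pure (0 : ℝ≥0), sup_comm]
    congr 2
    ext x
    simp [pos_iff_ne_zero]
  rw [h3]
  refine h2.sup ?_
  rw [tendsto_pure_left]
  intro s hs
  rw [F.koopman_zero_apply f]
  exact mem_of_mem_nhds hs

/-- Otherwise the norms would be unbounded along some `τ n → 0`, against Banach–Steinhaus, since
`U^(τ n) f → f`. -/
theorem exists_norm_U_le_nhds : ∃ δ > 0, ∃ C ≥ (1 : ℝ), ∀ τ ≤ δ, ‖F.U τ‖ ≤ C := by
  by_contra! hcon
  have h1 : ∀ n : ℕ, ∃ τ ≤ (1 / ((n : ℝ≥0) + 1)), (n : ℝ) + 1 < ‖F.U τ‖ := fun n =>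
    hcon _ (by positivity) _ (by linarith [Nat.cast_nonneg (α := ℝ) n])
  choose τ hτ hn using h1
  have hτ0 : Tendsto τ atTop (𝓝 0) :=
    tendsto_of_tendsto_of_tendsto_of_le_of_le tendsto_const_nhds
      (tendsto_one_div_add_atTop_nhds_zero_nat (𝕜 := ℝ≥0)) (fun _ => zero_le) hτ
  obtain ⟨C, hC⟩ := banach_steinhaus (g := fun n => F.U (τ n)) fun f => by
    obtain ⟨C, hC⟩ := (Metric.isBounded_range_of_tendsto _
      ((F.tendsto_U_apply f).comp hτ0)).exists_norm_le
    exact ⟨C, fun n => hC _ ⟨n, rfl⟩⟩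
  obtain ⟨n, hn'⟩ := exists_nat_gt C
  linarith [hn n, hC n]

theorem exists_norm_U_le (T : ℝ≥0) : ∃ C, ∀ τ ≤ T, ‖F.U τ‖ ≤ C := by
  obtain ⟨δ, hδ, C, hC1, hC⟩ := F.exists_norm_U_le_nhds
  have key : ∀ n : ℕ, ∀ τ ≤ n * δ, ‖F.U τ‖ ≤ C ^ (n + 1) := by
    intro n
    induction n with
    | zero => exact fun τ hτ => by simpa using hC τ (by simp at hτ; simp [hτ])
    | succ n ih =>
      intro τ hτ
      have h1 : F.U τ = F.U (min τ δ) * F.U (τ - min τ δ) := by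
        ext f
        rw [mul_apply_eq_comp, ← F.koopman_add_apply,
          add_tsub_cancel_of_le (min_le_left _ _)]
      have h2 : τ - min τ δ ≤ n * δ := by
        rw [tsub_le_iff_right]
        rcases le_total τ δ with h | h
        · rw [min_eq_left h]
          exact le_add_self
        · rw [min_eq_right h]
          refine hτ.trans_eq ?_
          push_cast
          ring
      rw [h1, pow_succ' C (n + 1)]
      exact (norm_mul_le _ _).trans (mul_le_mul (hC _ (min_le_right _ _)) (ih _ h2)
        (norm_nonneg _) (by positivity))
  obtain ⟨n, hn⟩ := exists_nat_ge (T / δ)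
  refine ⟨_, fun τ hτ => key n τ (hτ.trans ?_)⟩
  rwa [div_le_iff₀ hδ] at hn

/-- Factoring out the operator with the smaller time reduces continuity at `τ` to continuity at `0`,
with a locally uniform constant. -/
theorem continuous_U_apply (f : F.E) : Continuous fun τ : ℝ≥0 => F.U τ f := by
  rw [continuous_iff_continuousAt]
  intro τ
  obtain ⟨C, hC⟩ := F.exists_norm_U_le (τ + 1)
  have hle : ∀ᶠ σ in 𝓝 τ, ‖F.U σ f - F.U τ f‖ ≤ C * ‖F.U (nndist σ τ) f - f‖ := by
    filter_upwards [Iio_mem_nhds (lt_add_one τ)] with σ hσ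
    rcases le_total σ τ with h | h
    · have h1 : τ = σ + nndist σ τ := by
        rw [NNReal.nndist_eq, tsub_eq_zero_of_le h, max_eq_right zero_le,
          add_tsub_cancel_of_le h]
      conv_lhs => rw [h1, norm_sub_rev]
      rw [F.koopman_add_apply, ← map_sub]
      exact ContinuousLinearMap.le_of_opNorm_le _ (hC σ (Set.mem_Iio.1 hσ).le) _
    · have h1 : σ = τ + nndist σ τ := by
        rw [NNReal.nndist_eq, tsub_eq_zero_of_le h, max_eq_left zero_le,
          add_tsub_cancel_of_le h]
      conv_lhs => rw [h1]
      rw [F.koopman_add_apply, ← map_sub]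
      exact ContinuousLinearMap.le_of_opNorm_le _ (hC τ (le_add_of_nonneg_right zero_le_one)) _
  rw [ContinuousAt, tendsto_iff_norm_sub_tendsto_zero]
  refine squeeze_zero' (Eventually.of_forall fun _ => norm_nonneg _) hle ?_
  have h1 : Tendsto (fun σ => nndist σ τ) (𝓝 τ) (𝓝 0) := by
    have : Continuous fun σ => nndist σ τ := by fun_prop
    simpa using this.tendsto τ
  have h2 := (((F.tendsto_U_apply f).comp h1).sub_const f).norm.const_mul C
  simpa using h2

/-- The Koopman semigroup is the exponential of its generator. -/
theorem U_eq_exp (τ : ℝ≥0) : F.U τ = NormedSpace.exp (((τ : ℝ) : ℂ) • F.L) := by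
  ext f
  let u : ℝ → F.E := fun t => F.U t.toNNReal f
  have hu : ∀ t ∈ Set.Ico (0 : ℝ) τ, HasDerivWithinAt u (F.L (u t)) (Set.Ici t) t := by
    intro t ht
    rw [hasDerivWithinAt_iff_tendsto_slope, Set.Ici_sdiff_left]
    have h1 : Tendsto (fun s : ℝ => (s - t).toNNReal) (𝓝[>] t) (𝓝[>] 0) := by
      refine tendsto_nhdsWithin_iff.2 ⟨?_, ?_⟩
      · have : Continuous fun s : ℝ => (s - t).toNNReal := by fun_prop
        simpa using (this.tendsto t).mono_left nhdsWithin_le_nhds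
      · filter_upwards [self_mem_nhdsWithin] with s hs
        simpa using hs
    refine ((F.tendsto_L (u t)).comp h1).congr' ?_
    filter_upwards [self_mem_nhdsWithin] with s hs
    have hs' : 0 ≤ s - t := (sub_pos.2 hs).le
    have h2 : s.toNNReal = (s - t).toNNReal + t.toNNReal := by
      rw [← Real.toNNReal_add hs' ht.1, sub_add_cancel]
    simp only [Function.comp_apply, slope, vsub_eq_sub, u]
    rw [h2, F.koopman_add_apply, Real.coe_toNNReal _ hs', ← Complex.ofReal_inv, Complex.coe_smul]
  let e : ℝ → F.E := fun t => NormedSpace.exp (t • F.L) f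
  have he : ∀ t, HasDerivAt e (F.L (e t)) t := fun t => by
    have h1 := hasDerivAt_exp_smul_const' (𝕂 := ℝ) F.L t
    exact ((ContinuousLinearMap.apply ℂ F.E f).restrictScalars ℝ).hasFDerivAt.comp_hasDerivAt t h1
  have hcont : Continuous u := (F.continuous_U_apply f).comp continuous_real_toNNReal
  -- Only right derivatives of `u` are known; with continuity they suffice for uniqueness.
  have := ODE_solution_unique_of_mem_Icc_right (v := fun _ x => F.L x) (s := fun _ => Set.univ)
    (K := ‖F.L‖₊) (f := u) (g := e) (a := 0) (b := τ)
    (fun _ _ => F.L.lipschitz.lipschitzOnWith) hcont.continuousOn hu (fun _ _ => Set.mem_univ _)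
    (fun t _ => (he t).continuousAt.continuousWithinAt)
    (fun t _ => (he t).hasDerivWithinAt) (fun _ _ => Set.mem_univ _)
    (by simp [u, e, F.koopman_zero_apply])
  have h2 := this (Set.right_mem_Icc.2 τ.2)
  simpa [u, e, Complex.coe_smul] using h2

/-- The case `t < 0` follows from the case `-t` applied to `exp (t L) f`; in particular the space is
also invariant under backward shifts. -/
theorem sig_exp_smul_L (f : F.E) (t s : ℝ) :
    F.sig (NormedSpace.exp ((t : ℂ) • F.L) f) s = F.sig f (s + t) := by
  have hpos : ∀ (f : F.E) (t s : ℝ), 0 ≤ t →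
      F.sig (NormedSpace.exp ((t : ℂ) • F.L) f) s = F.sig f (s + t) := fun f t s ht => by
    have := F.U_eq_exp (NNReal.mk t ht)
    rw [NNReal.coe_mk] at this
    rw [← this, F.sig_koopman, NNReal.coe_mk]
  rcases le_total 0 t with ht | ht
  · exact hpos f t s ht
  · have h1 := hpos (NormedSpace.exp ((t : ℂ) • F.L) f) (-t) (s + t) (neg_nonneg.2 ht)
    rw [← exp_add_smul_apply, Complex.ofReal_neg, neg_add_cancel,
      zero_smul, NormedSpace.exp_zero, one_apply_eq_self, add_neg_cancel_right] at h1
    exact h1.symm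

theorem sig_eq_evalZero (f : F.E) (t : ℝ) :
    F.sig f t = F.evalZero (NormedSpace.exp ((t : ℂ) • F.L) f) := by
  rw [F.evalZero_apply, sig_exp_smul_L, zero_add]

theorem L_eq_of_forall_U_eq_exp {A : F.E →L[ℂ] F.E}
    (h : ∀ τ, F.U τ = NormedSpace.exp (((τ : ℝ) : ℂ) • A)) : F.L = A := by
  have h1 : ∀ t : ℝ, 0 ≤ t → NormedSpace.exp (t • F.L) = NormedSpace.exp (t • A) := fun t ht => by
    have h2 := (F.U_eq_exp (NNReal.mk t ht)).symm.trans (h (NNReal.mk t ht))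
    simpa [Complex.coe_smul] using h2
  have h2 := (hasDerivAt_exp_smul_const (𝕂 := ℝ) F.L 0).hasDerivWithinAt (s := Set.Ici 0)
  have h3 := (hasDerivAt_exp_smul_const (𝕂 := ℝ) A 0).hasDerivWithinAt (s := Set.Ici 0)
  have h4 := h3.congr (fun t ht => h1 t ht) (h1 0 le_rfl)
  simpa using (uniqueDiffWithinAt_Ici (0 : ℝ)).eq_deriv _ h2 h4

theorem bddAbove_abs_im : BddAbove ((fun z : ℂ => |z.im|) '' spectrum ℂ F.L) :=
  ((spectrum.isCompact F.L).image (by fun_prop)).bddAbove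

theorem abs_im_le_maxIm {z : ℂ} (hz : z ∈ spectrum ℂ F.L) : |z.im| ≤ F.maxIm :=
  le_csSup F.bddAbove_abs_im ⟨z, hz, rfl⟩

theorem maxIm_nonneg : 0 ≤ F.maxIm :=
  Real.sSup_nonneg <| by
    rintro _ ⟨z, _, rfl⟩
    exact abs_nonneg _

theorem maxIm_le {r : ℝ} (hr : 0 ≤ r) (h : ∀ z ∈ spectrum ℂ F.L, |z.im| ≤ r) : F.maxIm ≤ r :=
  Real.sSup_le (by rintro _ ⟨z, hz, rfl⟩; exact h z hz) hr

theorem maxIm_lt_iff {r : ℝ} (hr : 0 < r) :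
    F.maxIm < r ↔ ∀ z ∈ spectrum ℂ F.L, |z.im| < r := by
  refine ⟨fun h z hz => (F.abs_im_le_maxIm hz).trans_lt h, fun h => ?_⟩
  -- On the zero space the spectrum is empty and `sSup ∅ = 0 < r`; otherwise compactness attains the
  -- supremum.
  rcases (spectrum ℂ F.L).eq_empty_or_nonempty with he | hne
  · simpa [maxIm, he] using hr
  · obtain ⟨z, hz, hz'⟩ := ((spectrum.isCompact F.L).image
      (f := fun z : ℂ => |z.im|) (by fun_prop)).sSup_mem (hne.image _)
    exact hz'.symm.trans_lt (h z hz)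

theorem abs_im_lt_of_mem_spectrum_smul {T r : ℝ} (hT : 0 < T) (h : F.maxIm < r / T) {z : ℂ}
    (hz : z ∈ spectrum ℂ ((T : ℂ) • F.L)) : |z.im| < r := by
  have hT' : (T : ℂ) ≠ 0 := by exact_mod_cast hT.ne'
  rw [← Units.val_mk0 hT', ← Units.smul_def, spectrum.unit_smul_eq_smul] at hz
  obtain ⟨w, hw, rfl⟩ := hz
  have h1 := (F.abs_im_le_maxIm hw).trans_lt h
  rw [lt_div_iff₀ hT] at h1
  simpa [Units.smul_def, abs_mul, abs_of_pos hT, mul_comm] using h1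

/-- `T • L` is a principal logarithm of `U^T` iff the sampling frequency `2π / T` exceeds twice the
largest frequency of the space. -/
theorem isPrincipalLog_smul_L_iff {T : ℝ≥0} (hT : 0 < T) :
    IsPrincipalLog (F.U T) (((T : ℝ) : ℂ) • F.L) ↔ F.maxIm < Real.pi / T := by
  have hT0 : (0 : ℝ) < T := hT
  refine ⟨fun h => ?_, fun h => ⟨(F.U_eq_exp T).symm, fun z hz =>
    abs_lt.1 (F.abs_im_lt_of_mem_spectrum_smul hT0 h hz)⟩⟩
  rw [F.maxIm_lt_iff (by positivity)]
  intro z hz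
  have hT' : ((T : ℝ) : ℂ) ≠ 0 := by exact_mod_cast hT0.ne'
  have h1 : ((T : ℝ) : ℂ) * z ∈ spectrum ℂ (((T : ℝ) : ℂ) • F.L) := by
    rw [show ((T : ℝ) : ℂ) • F.L = (Units.mk0 _ hT') • F.L from rfl, spectrum.unit_smul_eq_smul]
    exact ⟨z, hz, rfl⟩
  have h2 := h.2 h1
  rw [Set.mem_ofPred_eq, Complex.im_ofReal_mul, ← abs_lt, abs_mul, abs_of_pos hT0] at h2
  rwa [lt_div_iff₀ hT0, mul_comm]

end GeneratorBoundedSpace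

theorem IsPrincipalLog.unique {E : Type*} [NormedAddCommGroup E] [NormedSpace ℂ E]
    [CompleteSpace E] {Y B B' : E →L[ℂ] E} (h : IsPrincipalLog Y B) (h' : IsPrincipalLog Y B') :
    B = B' :=
  eq_of_exp_eq_exp_of_abs_im_spectrum_lt (fun _ hz => abs_lt.2 (h.2 hz))
    (fun _ hz => abs_lt.2 (h'.2 hz)) (h.1.trans h'.1.symm)

theorem IsPrincipalLog.principalLog_eq {E : Type*} [NormedAddCommGroup E] [NormedSpace ℂ E]
    [CompleteSpace E] {Y B : E →L[ℂ] E} (h : IsPrincipalLog Y B) : principalLog Y = B := by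
  have hex : ∃ B, IsPrincipalLog Y B := ⟨B, h⟩
  rw [principalLog, dif_pos hex]
  exact hex.choose_spec.unique h

theorem GeneratorBoundedSpace.sig_eq_exp_principalLog (F : GeneratorBoundedSpace) {T : ℝ≥0}
    (hT : 0 < T) (h : F.maxIm < Real.pi / T) (f : F.E) (t : ℝ) :
    F.sig f t = F.sig (NormedSpace.exp (((t / T : ℝ) : ℂ) • principalLog (F.U T)) f) 0 := by
  have hT0 : (T : ℝ) ≠ 0 := (NNReal.coe_pos.2 hT).ne'
  rw [((F.isPrincipalLog_smul_L_iff hT).2 h).principalLog_eq, smul_smul, ← Complex.ofReal_mul,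
    div_mul_cancel₀ _ hT0, F.sig_exp_smul_L, zero_add]

/-! ### Intertwined exponentials, and spectral strips from growth. -/

section Intertwining

theorem map_pow_apply_of_intertwining {X Y : Type*} [NormedAddCommGroup X] [NormedSpace ℂ X]
    [NormedAddCommGroup Y] [NormedSpace ℂ Y] {A : X →L[ℂ] X} {B : Y →L[ℂ] Y}
    (T : X →L[ℂ] Y) (h : ∀ x, T (A x) = B (T x)) (n : ℕ) (x : X) : T ((A ^ n) x) = (B ^ n) (T x) := by
  induction n generalizing x with
  | zero => rfl
  | succ n ih => rw [pow_succ, pow_succ, mul_apply_eq_comp, mul_apply_eq_comp, ih, h]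

variable {X Y : Type*} [NormedAddCommGroup X] [NormedSpace ℂ X] [CompleteSpace X]
  [NormedAddCommGroup Y] [NormedSpace ℂ Y] [CompleteSpace Y]

theorem hasSum_exp_apply (A : X →L[ℂ] X) (x : X) :
    HasSum (fun n : ℕ => ((n.factorial : ℂ)⁻¹) • (A ^ n) x) (NormedSpace.exp A x) := by
  simpa using (NormedSpace.exp_series_hasSum_exp' (𝕂 := ℂ) A).mapL (ContinuousLinearMap.apply ℂ X x)

theorem map_exp_apply_of_intertwining {A : X →L[ℂ] X} {B : Y →L[ℂ] Y} (T : X →L[ℂ] Y)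
    (h : ∀ x, T (A x) = B (T x)) (x : X) :
    T (NormedSpace.exp A x) = NormedSpace.exp B (T x) := by
  refine ((T.hasSum (hasSum_exp_apply A x)).unique ?_)
  simpa only [map_smul, map_pow_apply_of_intertwining T h] using hasSum_exp_apply B (T x)

theorem map_exp_smul_apply_of_intertwining {A : X →L[ℂ] X} {B : Y →L[ℂ] Y} (T : X →L[ℂ] Y)
    (h : ∀ x, T (A x) = B (T x)) (c : ℂ) (x : X) :
    T (NormedSpace.exp (c • A) x) = NormedSpace.exp (c • B) (T x) :=
  map_exp_apply_of_intertwining T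
    (fun x => by rw [smul_apply, smul_apply, map_smul, h]) x

theorem hasDerivAt_exp_smul_apply (A : X →L[ℂ] X) (x : X) (t : ℝ) :
    HasDerivAt (fun t : ℝ => NormedSpace.exp ((t : ℂ) • A) x)
      (NormedSpace.exp ((t : ℂ) • A) (A x)) t := by
  have h1 := hasDerivAt_exp_smul_const (𝕂 := ℝ) A t
  have h2 := ((ContinuousLinearMap.apply ℂ X x).restrictScalars ℝ).hasFDerivAt.comp_hasDerivAt t h1
  simp only [Complex.coe_smul]
  exact h2

/-- If `exp (iyA)` grows at most like `exp (r |y|)`, then the spectrum of `A` lies in the strip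
`|Im z| ≤ r`. -/
theorem abs_im_le_of_norm_exp_le {A : X →L[ℂ] X} {r : ℝ}
    (h : ∀ ε > 0, ∃ C, ∀ y : ℝ, ‖NormedSpace.exp ((Complex.I * y) • A)‖ ≤
      C * Real.exp ((r + ε) * |y|)) {z : ℂ} (hz : z ∈ spectrum ℂ A) : |z.im| ≤ r := by
  refine le_of_forall_pos_le_add fun ε hε => ?_
  obtain ⟨C, hC⟩ := h ε hε
  by_contra! hlt
  set d := |z.im| - (r + ε) with hd
  have hd0 : 0 < d := sub_pos.2 hlt
  -- For `y` of sign opposite to `Im z`, the spectral value `exp (iyz)` of `exp (iyA)` has modulus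
  -- `exp (|y| |Im z|)`. Comparison with the growth bound makes `exp (d s)`, hence `d s`, bounded in
  -- `s`.
  have key : ∀ s : ℝ, 0 < s → d * s ≤ C * ‖(1 : X →L[ℂ] X)‖ := by
    intro s hs
    obtain ⟨y, hy, hy'⟩ : ∃ y : ℝ, |y| = s ∧ -(y * z.im) = s * |z.im| := by
      rcases le_total 0 z.im with h0 | h0
      · exact ⟨-s, by rw [abs_neg, abs_of_pos hs], by rw [abs_of_nonneg h0]; ring⟩
      · exact ⟨s, abs_of_pos hs, by rw [abs_of_nonpos h0]; ring⟩
    have hy0 : Complex.I * (y : ℂ) ≠ 0 := by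
      refine mul_ne_zero Complex.I_ne_zero ?_
      rintro h0
      rw [Complex.ofReal_eq_zero.1 h0, abs_zero] at hy
      exact hs.ne hy
    have h1 : Complex.I * y * z ∈ spectrum ℂ ((Complex.I * (y : ℂ)) • A) := by
      rw [show (Complex.I * (y : ℂ)) • A = (Units.mk0 _ hy0) • A from rfl,
        spectrum.unit_smul_eq_smul]
      exact ⟨z, hz, rfl⟩
    have h2 := spectrum.norm_le_norm_mul_of_mem (spectrum.exp_mem_exp _ h1)
    rw [← Complex.exp_eq_exp_ℂ, Complex.norm_exp,
      show (Complex.I * y * z).re = s * |z.im| by rw [← hy']; simp] at h2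
    have h3 := h2.trans (mul_le_mul_of_nonneg_right (hC y) (norm_nonneg _))
    rw [hy, show s * |z.im| = d * s + (r + ε) * s by rw [hd]; ring, Real.exp_add,
      mul_right_comm] at h3
    have h4 := le_of_mul_le_mul_right h3 (Real.exp_pos _)
    exact (by linarith [Real.add_one_le_exp (d * s)] : d * s ≤ Real.exp (d * s)).trans h4
  have h1 := key ((|C * ‖(1 : X →L[ℂ] X)‖| + 1) / d) (by positivity)
  rw [mul_div_cancel₀ _ hd0.ne'] at h1
  linarith [le_abs_self (C * ‖(1 : X →L[ℂ] X)‖)]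

end Intertwining

/-! ### Generator-bounded spaces from observable linear systems. -/

section OfGenerator

variable {X : Type} [NormedAddCommGroup X] [NormedSpace ℂ X] [CompleteSpace X]

/-- The signals `t ↦ φ (exp (tA) x)` of an observable linear system. -/
noncomputable def signalSpaceOfGenerator [TopologicalSpace.SeparableSpace X]
    (A : X →L[ℂ] X) (φ : X →L[ℂ] ℂ)
    (h : ∀ x, (∀ t : ℝ, φ (NormedSpace.exp ((t : ℂ) • A) x) = 0) → x = 0) :
    ShiftInvariantSpace where
  E := X
  sig := LinearMap.pi fun t : ℝ => (φ ∘L NormedSpace.exp ((t : ℂ) • A)).toLinearMap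
  sig_injective := by
    rw [← LinearMap.ker_eq_bot, LinearMap.ker_eq_bot']
    exact fun x hx => h x fun t => congrFun hx t
  continuous_eval t := (φ ∘L NormedSpace.exp ((t : ℂ) • A)).continuous
  shift_mem τ x := ⟨NormedSpace.exp (((τ : ℝ) : ℂ) • A) x, fun t => by
    refine congrArg φ ?_
    rw [Complex.ofReal_add]
    exact (exp_add_smul_apply A t τ x).symm⟩

variable [TopologicalSpace.SeparableSpace X] (A : X →L[ℂ] X) (φ : X →L[ℂ] ℂ)
    (h : ∀ x, (∀ t : ℝ, φ (NormedSpace.exp ((t : ℂ) • A) x) = 0) → x = 0)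

theorem koopman_signalSpaceOfGenerator (τ : ℝ≥0) :
    (signalSpaceOfGenerator A φ h).koopman τ = NormedSpace.exp (((τ : ℝ) : ℂ) • A) := by
  ext x
  refine (signalSpaceOfGenerator A φ h).sig_injective (funext fun t => ?_)
  rw [ShiftInvariantSpace.sig_koopman]
  refine congrArg φ ?_
  rw [Complex.ofReal_add]
  exact exp_add_smul_apply A t τ x

/-- The generator-bounded space of the signals `t ↦ φ (exp (tA) x)` of an observable linear
system. -/
noncomputable def generatorBoundedSpaceOfGenerator : GeneratorBoundedSpace where
  toShiftInvariantSpace := signalSpaceOfGenerator A φ h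
  exists_generator := ⟨A, fun x => by
    have h1 := (hasDerivAt_exp_smul_apply A x 0).tendsto_slope
    have h2 : Tendsto (fun τ : ℝ≥0 => (τ : ℝ)) (𝓝[>] 0) (𝓝[≠] 0) := by
      refine tendsto_nhdsWithin_iff.2 ⟨?_, ?_⟩
      · have : Continuous fun τ : ℝ≥0 => (τ : ℝ) := by fun_prop
        simpa using (this.tendsto 0).mono_left nhdsWithin_le_nhds
      · filter_upwards [self_mem_nhdsWithin] with τ hτ
        exact_mod_cast (ne_of_gt hτ)
    have h3 := h1.comp h2
    rw [Complex.ofReal_zero, zero_smul, NormedSpace.exp_zero] at h3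
    refine h3.congr fun τ => ?_
    rw [koopman_signalSpaceOfGenerator]
    simp only [Function.comp_apply, slope, vsub_eq_sub, sub_zero, Complex.ofReal_zero, zero_smul,
      NormedSpace.exp_zero]
    rw [← Complex.ofReal_inv, Complex.coe_smul]
    rfl⟩

theorem generatorBoundedSpaceOfGenerator_L : (generatorBoundedSpaceOfGenerator A φ h).L = A :=
  GeneratorBoundedSpace.L_eq_of_forall_U_eq_exp _ fun τ => koopman_signalSpaceOfGenerator A φ h τ

end OfGenerator

/-! ### Reduction to an orbit closure and to its observable quotient. -/

section Realization

variable {X : Type} [NormedAddCommGroup X] [NormedSpace ℂ X]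

/-- The span of the orbit of `v` under `L`. -/
def orbitSpan (L : X →L[ℂ] X) (v : X) : Submodule ℂ X :=
  Submodule.span ℂ (Set.range fun n : ℕ => (L ^ n) v)

theorem map_mem_orbitSpan (L : X →L[ℂ] X) (v : X) : ∀ x ∈ orbitSpan L v, L x ∈ orbitSpan L v := by
  intro x hx
  have : orbitSpan L v ≤ (orbitSpan L v).comap L.toLinearMap := by
    refine Submodule.span_le.2 ?_
    rintro _ ⟨n, rfl⟩
    refine Submodule.subset_span ⟨n + 1, ?_⟩
    dsimp only
    rw [pow_succ']
    rfl
  exact this hx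

variable [CompleteSpace X]

/-- The restriction of an operator to a closed invariant subspace. -/
theorem exists_restriction (L : X →L[ℂ] X) {M : Submodule ℂ X} (hM : IsClosed (M : Set X))
    (hsep : TopologicalSpace.IsSeparable (M : Set X)) (hL : ∀ x ∈ M, L x ∈ M) :
    ∃ (Y : Type) (_ : NormedAddCommGroup Y) (_ : NormedSpace ℂ Y) (_ : CompleteSpace Y)
      (_ : TopologicalSpace.SeparableSpace Y) (ι : Y →L[ℂ] X) (A : Y →L[ℂ] Y),
      (∀ y, ‖ι y‖ = ‖y‖) ∧ (∀ x, x ∈ M ↔ ∃ y, ι y = x) ∧ ∀ y, ι (A y) = L (ι y) :=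
  ⟨M, inferInstance, inferInstance, hM.completeSpace_coe, hsep.separableSpace, M.subtypeL,
    L.restrict hL, fun _ => rfl, fun x => ⟨fun hx => ⟨⟨x, hx⟩, rfl⟩, by rintro ⟨y, rfl⟩; exact y.2⟩,
    fun _ => rfl⟩

/-- The operator induced on the quotient by a closed invariant subspace. -/
theorem exists_quotient [TopologicalSpace.SeparableSpace X] (L : X →L[ℂ] X) {N : Submodule ℂ X}
    (hN : IsClosed (N : Set X)) (hL : ∀ x ∈ N, L x ∈ N) (φ : X →L[ℂ] ℂ) (hφ : ∀ x ∈ N, φ x = 0) :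
    ∃ (Y : Type) (_ : NormedAddCommGroup Y) (_ : NormedSpace ℂ Y) (_ : CompleteSpace Y)
      (_ : TopologicalSpace.SeparableSpace Y) (π : X →L[ℂ] Y) (A : Y →L[ℂ] Y) (ψ : Y →L[ℂ] ℂ),
      (∀ x, ‖π x‖ ≤ ‖x‖) ∧ (∀ y, ∀ δ > 0, ∃ x, π x = y ∧ ‖x‖ < ‖y‖ + δ) ∧
      (∀ x, π x = 0 ↔ x ∈ N) ∧ (∀ x, π (L x) = A (π x)) ∧ ∀ x, ψ (π x) = φ x :=
  ⟨X ⧸ N, inferInstance, inferInstance, inferInstance,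
    N.isQuotientMap_mkQL.separableSpace, N.mkQL,
    N.liftQL (N.mkQL ∘L L) fun x hx => (Submodule.Quotient.mk_eq_zero N).2 (hL x hx),
    N.liftQL φ hφ, fun x => Submodule.Quotient.norm_mk_le N x,
    fun y _ hδ => Submodule.Quotient.norm_mk_lt y hδ, fun _ => Submodule.Quotient.mk_eq_zero N,
    fun _ => rfl, fun _ => rfl⟩

/-- Dividing by the unobservable states `N` makes states determined by their signals. The spectrum
of a quotient operator need not lie in that of `L`, so the frequencies are controlled through the
growth of `exp (iyL)`, which does pass to quotients. -/
theorem exists_generatorBoundedSpace_of_separable [TopologicalSpace.SeparableSpace X]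
    (L : X →L[ℂ] X) (v : X) (φ : X →L[ℂ] ℂ) {r : ℝ} (hr : 0 ≤ r)
    (hgrow : ∀ ε > 0, ∃ C, ∀ y : ℝ, ∀ x,
      ‖NormedSpace.exp ((Complex.I * y) • L) x‖ ≤ C * Real.exp ((r + ε) * |y|) * ‖x‖) :
    ∃ F : GeneratorBoundedSpace, F.Contains (fun t => φ (NormedSpace.exp ((t : ℂ) • L) v)) ∧
      F.maxIm ≤ r := by
  let N : Submodule ℂ X := ⨅ t : ℝ, (φ ∘L NormedSpace.exp ((t : ℂ) • L)).ker
  have hN : ∀ x, x ∈ N ↔ ∀ t : ℝ, φ (NormedSpace.exp ((t : ℂ) • L) x) = 0 := fun x => by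
    simp [N, Submodule.mem_iInf]
  have hNc : IsClosed (N : Set X) := by
    have : (N : Set X) = ⋂ t : ℝ, ((φ ∘L NormedSpace.exp ((t : ℂ) • L)).ker : Set X) := by
      simp only [N, Submodule.coe_iInf]
    rw [this]
    exact isClosed_iInter fun t => ContinuousLinearMap.isClosed_ker _
  -- Differentiate the identity `φ (exp (t L) x) = 0` in `t`.
  have hLN : ∀ x ∈ N, L x ∈ N := fun x hx => by
    rw [hN] at hx ⊢
    intro t
    have h1 := (φ.restrictScalars ℝ).hasFDerivAt.comp_hasDerivAt t
      (hasDerivAt_exp_smul_apply L x t)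
    have h2 : (φ.restrictScalars ℝ) ∘ (fun t : ℝ => NormedSpace.exp ((t : ℂ) • L) x) =
        fun _ => 0 := funext hx
    rw [h2] at h1
    exact h1.unique (hasDerivAt_const t 0)
  obtain ⟨Y, _, _, _, _, π, A, ψ, hπ, hπ', hker, hA, hψ⟩ := exists_quotient L hNc hLN φ
    fun x hx => by simpa using (hN x).1 hx 0
  have hAexp : ∀ (c : ℂ) (x : X),
      π (NormedSpace.exp (c • L) x) = NormedSpace.exp (c • A) (π x) :=
    map_exp_smul_apply_of_intertwining π hA
  have hψexp : ∀ (t : ℝ) (x : X), ψ (NormedSpace.exp ((t : ℂ) • A) (π x)) =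
      φ (NormedSpace.exp ((t : ℂ) • L) x) := fun t x => by rw [← hAexp, hψ]
  have hobs : ∀ x, (∀ t : ℝ, ψ (NormedSpace.exp ((t : ℂ) • A) x) = 0) → x = 0 := by
    intro x hx
    obtain ⟨x, rfl, -⟩ := hπ' x 1 one_pos
    refine (hker x).2 ((hN x).2 fun t => ?_)
    rw [← hψexp, hx]
  have hgA : ∀ ε > 0, ∃ C, ∀ y : ℝ, ‖NormedSpace.exp ((Complex.I * y) • A)‖ ≤
      C * Real.exp ((r + ε) * |y|) := by
    intro ε hε
    obtain ⟨C, hC⟩ := hgrow ε hε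
    refine ⟨max C 0, fun y => ?_⟩
    set K := max C 0 * Real.exp ((r + ε) * |y|) with hK
    have hK0 : 0 ≤ K := by positivity
    refine ContinuousLinearMap.opNorm_le_bound _ hK0 fun q => ?_
    refine le_of_forall_pos_le_add fun δ hδ => ?_
    obtain ⟨x, rfl, hx⟩ := hπ' q (δ / (K + 1)) (by positivity)
    calc ‖NormedSpace.exp ((Complex.I * y) • A) (π x)‖
        ≤ ‖NormedSpace.exp ((Complex.I * y) • L) x‖ := by
          rw [← hAexp]
          exact hπ _
      _ ≤ K * ‖x‖ := by
          refine (hC y x).trans ?_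
          rw [hK]
          gcongr
          exact le_max_left _ _
      _ ≤ K * (‖π x‖ + δ / (K + 1)) := by gcongr
      _ ≤ K * ‖π x‖ + δ := by
          rw [mul_add]
          gcongr
          rw [← mul_div_assoc, div_le_iff₀ (by positivity)]
          nlinarith
  refine ⟨generatorBoundedSpaceOfGenerator A ψ hobs, ⟨π v, funext fun t => hψexp t v⟩, ?_⟩
  refine GeneratorBoundedSpace.maxIm_le _ hr ?_
  rw [generatorBoundedSpaceOfGenerator_L]
  exact fun z hz => abs_im_le_of_norm_exp_le hgA hz

/-- Signals `t ↦ φ (exp (tL) v)` lie in a generator-bounded space whose generator is a subquotient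
of `L`; the growth of `exp (iyL)` on the orbit of `v` bounds the frequencies. -/
theorem exists_generatorBoundedSpace (L : X →L[ℂ] X) (v : X) (φ : X →L[ℂ] ℂ) {r : ℝ} (hr : 0 ≤ r)
    (hgrow : ∀ ε > 0, ∃ C, ∀ y : ℝ, ∀ x ∈ orbitSpan L v,
      ‖NormedSpace.exp ((Complex.I * y) • L) x‖ ≤ C * Real.exp ((r + ε) * |y|) * ‖x‖) :
    ∃ F : GeneratorBoundedSpace, F.Contains (fun t => φ (NormedSpace.exp ((t : ℂ) • L) v)) ∧
      F.maxIm ≤ r := by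
  -- `X` need not be separable, but the closed span of a single orbit is.
  obtain ⟨Y, _, _, _, _, ι, A, hι, hM, hA⟩ := exists_restriction L
    (M := (orbitSpan L v).topologicalClosure) (Submodule.isClosed_topologicalClosure _)
    (by
      rw [Submodule.topologicalClosure_coe]
      exact ((Set.countable_range _).isSeparable.span (R := ℂ)).closure)
    (fun x hx => map_mem_closure L.continuous hx (map_mem_orbitSpan L v))
  have hAexp : ∀ (c : ℂ) (y : Y),
      ι (NormedSpace.exp (c • A) y) = NormedSpace.exp (c • L) (ι y) :=
    map_exp_smul_apply_of_intertwining ι hA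
  obtain ⟨w, hw⟩ :=
    (hM v).1 (Submodule.le_topologicalClosure _ (Submodule.subset_span ⟨0, rfl⟩))
  obtain ⟨F, hF, hF'⟩ := exists_generatorBoundedSpace_of_separable A w (φ ∘L ι) hr fun ε hε => by
    obtain ⟨C, hC⟩ := hgrow ε hε
    refine ⟨C, fun y x => ?_⟩
    rw [← hι, ← hι x, hAexp]
    have hcl : IsClosed {x | ‖NormedSpace.exp ((Complex.I * y) • L) x‖ ≤
        C * Real.exp ((r + ε) * |y|) * ‖x‖} :=
      isClosed_le (by fun_prop) (by fun_prop)
    exact closure_minimal (hC y) hcl ((hM (ι x)).2 ⟨x, rfl⟩)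
  refine ⟨F, ?_, hF'⟩
  convert hF using 2 with t
  rw [ContinuousLinearMap.comp_apply, hAexp, hw]

end Realization

/-! ### A weighted supremum norm realizing prescribed growth. -/

/-- Index set for the weighted supremum norm: a weight, a point of the imaginary axis and an order
of differentiation. -/
structure WeightIndex where
  weight : ℕ
  height : ℝ
  order : ℕ

namespace WeightIndex

instance : TopologicalSpace WeightIndex := ⊥

instance : DiscreteTopology WeightIndex := ⟨rfl⟩

/-- Increase the order of differentiation. -/
def succ : C(WeightIndex, WeightIndex) where
  toFun i := ⟨i.weight, i.height, i.order + 1⟩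
  continuous_toFun := continuous_of_discreteTopology

end WeightIndex

open BoundedContinuousFunction in
/-- Differentiation in weighted coordinates. -/
noncomputable def weightedShift (A : ℝ) : (WeightIndex →ᵇ ℂ) →L[ℂ] (WeightIndex →ᵇ ℂ) :=
  LinearMap.mkContinuous
    { toFun u := (A : ℂ) • u.compContinuous WeightIndex.succ
      map_add' u v := by ext i; simp
      map_smul' c u := by ext i; simp; ring }
    ‖(A : ℂ)‖ fun u => by
      refine (norm_smul_le _ _).trans ?_
      gcongr
      exact (norm_le (norm_nonneg u)).2 fun i => u.norm_coe_le_norm _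

theorem weightedShift_apply (A : ℝ) (u : BoundedContinuousFunction WeightIndex ℂ) (n : ℕ) (y : ℝ)
    (k : ℕ) : weightedShift A u ⟨n, y, k⟩ = A * u ⟨n, y, k + 1⟩ := rfl

theorem weightedShift_pow_apply (A : ℝ) (u : BoundedContinuousFunction WeightIndex ℂ) (n : ℕ)
    (y : ℝ) (k j : ℕ) : (weightedShift A ^ j) u ⟨n, y, k⟩ = A ^ j * u ⟨n, y, k + j⟩ := by
  induction j generalizing k with
  | zero => simp
  | succ j ih =>
    rw [pow_succ', mul_apply_eq_comp, weightedShift_apply, ih, pow_succ', mul_assoc,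
      add_right_comm, add_assoc]

theorem exp_smul_comm_apply {E : Type*} [NormedAddCommGroup E] [NormedSpace ℂ E] [CompleteSpace E]
    (A : E →L[ℂ] E) (c : ℂ) (x : E) :
    NormedSpace.exp (c • A) (A x) = A (NormedSpace.exp (c • A) x) :=
  (map_exp_smul_apply_of_intertwining A (fun _ => rfl) c x).symm

/-- An entire function, given with its derivatives `G k`, which grows on the imaginary axis at most
like `exp ((h + ε) |y|)` for every `ε > 0`, lies in a generator-bounded space with frequencies at
most `h`. -/
theorem exists_generatorBoundedSpace_of_growth {G : ℕ → ℂ → ℂ} {h A : ℝ} {C : ℕ → ℝ} (hh : 0 ≤ h)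
    (hA : 0 < A) (hC : ∀ n, 1 ≤ C n)
    (hG : ∀ k s z, HasSum (fun j : ℕ => ((j.factorial : ℂ)⁻¹ * z ^ j) * G (k + j) s) (G k (s + z)))
    (hbound : ∀ n k (y : ℝ),
      ‖G k (Complex.I * y)‖ ≤ C n * A ^ k * Real.exp ((h + 1 / ((n : ℝ) + 1)) * |y|)) :
    ∃ F : GeneratorBoundedSpace, F.Contains (fun t => G 0 t) ∧ F.maxIm ≤ h := by
  -- The same value `G k (iy)` is recorded once for each `n`, divided by the `n`-th growth bound;
  -- `hbound` says exactly that the resulting `V` is bounded by `1`.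
  let w : ℕ → ℝ → ℝ := fun n y => C n * Real.exp ((h + 1 / ((n : ℝ) + 1)) * |y|)
  have hC0 : ∀ n, 0 < C n := fun n => one_pos.trans_le (hC n)
  have hw : ∀ n y, 0 < w n y := fun n y => mul_pos (hC0 n) (Real.exp_pos _)
  let V : BoundedContinuousFunction WeightIndex ℂ :=
    BoundedContinuousFunction.ofNormedAddCommGroupDiscrete
      (fun i => G i.order (Complex.I * i.height) / (A ^ i.order * w i.weight i.height : ℝ)) 1
      fun i => by
        have hpos : 0 < A ^ i.order * w i.weight i.height := mul_pos (pow_pos hA _) (hw _ _)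
        rw [norm_div, Complex.norm_real, Real.norm_of_nonneg hpos.le, div_le_one hpos]
        refine (hbound i.weight i.order i.height).trans_eq ?_
        simp only [w]
        ring
  have hV : ∀ n y k, V ⟨n, y, k⟩ = G k (Complex.I * y) / (A ^ k * w n y : ℝ) := fun _ _ _ => rfl
  let L := weightedShift A
  have hexpV : ∀ (z : ℂ) n y k, (w n y : ℂ) * NormedSpace.exp (z • L) V ⟨n, y, k⟩ =
      G k (Complex.I * y + z) / (A : ℂ) ^ k := by
    intro z n y k
    have hw' : (w n y : ℂ) ≠ 0 := by exact_mod_cast (hw n y).ne'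
    have hA' : (A : ℂ) ≠ 0 := by exact_mod_cast hA.ne'
    have h1 := ((hasSum_exp_apply (z • L) V).mapL
      (BoundedContinuousFunction.evalCLM ℂ (⟨n, y, k⟩ : WeightIndex))).mul_left (w n y : ℂ)
    have h2 := (hG k (Complex.I * y) z).div_const ((A : ℂ) ^ k)
    refine h1.unique (h2.congr_fun fun j => ?_)
    rw [smul_pow]
    simp only [BoundedContinuousFunction.evalCLM_apply, smul_apply,
      BoundedContinuousFunction.coe_smul, smul_eq_mul]
    rw [weightedShift_pow_apply, hV]
    push_cast
    field_simp
    ring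
  -- On the orbit span `exp (iy'L)` translates the heights by `y'`. Unweighted values do not depend
  -- on the weight index, so `m` on the right can be chosen freely.
  have hkey : ∀ x ∈ orbitSpan L V, ∀ (y' : ℝ) n m y k,
      (w n y : ℂ) * NormedSpace.exp ((Complex.I * y') • L) x ⟨n, y, k⟩ =
        w m (y + y') * x ⟨m, y + y', k⟩ := by
    intro x hx y' n m
    refine Submodule.span_induction (p := fun x _ => ∀ y k,
      (w n y : ℂ) * NormedSpace.exp ((Complex.I * y') • L) x ⟨n, y, k⟩ =
        w m (y + y') * x ⟨m, y + y', k⟩) ?_ ?_ ?_ ?_ hx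
    · rintro _ ⟨j, rfl⟩
      induction j with
      | zero =>
        intro y k
        have hw' : (w m (y + y') : ℂ) ≠ 0 := by exact_mod_cast (hw m (y + y')).ne'
        change (w n y : ℂ) * NormedSpace.exp ((Complex.I * y') • L) V ⟨n, y, k⟩ =
          w m (y + y') * V ⟨m, y + y', k⟩
        rw [hexpV, hV, ← mul_add, ← Complex.ofReal_add]
        push_cast
        field_simp
      | succ j ih =>
        intro y k
        dsimp only at ih ⊢
        rw [pow_succ', mul_apply_eq_comp, exp_smul_comm_apply, weightedShift_apply,
          weightedShift_apply, mul_left_comm, ih, mul_left_comm]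
    · intro y k
      simp
    · intro x x' _ _ hx hx' y k
      rw [map_add, BoundedContinuousFunction.add_apply, BoundedContinuousFunction.add_apply,
        mul_add, hx, hx', mul_add]
    · intro c x _ hx y k
      rw [map_smul, BoundedContinuousFunction.smul_apply, BoundedContinuousFunction.smul_apply,
        smul_eq_mul, smul_eq_mul, mul_left_comm, hx, mul_left_comm]
  have hgrow : ∀ ε > 0, ∃ C, ∀ y : ℝ, ∀ x ∈ orbitSpan L V,
      ‖NormedSpace.exp ((Complex.I * y) • L) x‖ ≤ C * Real.exp ((h + ε) * |y|) * ‖x‖ := by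
    intro ε hε
    obtain ⟨n₀, hn₀⟩ := exists_nat_one_div_lt hε
    refine ⟨C n₀, fun y' x hx => ?_⟩
    have hpos : 0 ≤ C n₀ * Real.exp ((h + ε) * |y'|) * ‖x‖ :=
      mul_nonneg (mul_nonneg (hC0 _).le (Real.exp_pos _).le) (norm_nonneg _)
    refine (BoundedContinuousFunction.norm_le hpos).2 ?_
    rintro ⟨n, y, k⟩
    -- This makes `1/(m+1)` at most both `1/(n+1)` and `ε`, so that weight `m` at `y + y'` splits
    -- into weight `n` at `y` and `exp ((h + ε) |y'|)`. Since all constants are at least `1`, `C m ≤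
    -- C n * C n₀`.
    set m := max n n₀ with hm
    have h1 := congrArg norm (hkey x hx y' n m y k)
    rw [norm_mul, norm_mul, Complex.norm_real, Complex.norm_real, Real.norm_of_nonneg (hw _ _).le,
      Real.norm_of_nonneg (hw _ _).le] at h1
    have h2 : w m (y + y') ≤ w n y * (C n₀ * Real.exp ((h + ε) * |y'|)) := by
      have hCm : C m ≤ C n * C n₀ := by
        rcases max_choice n n₀ with h | h
        · rw [hm, h]
          exact le_mul_of_one_le_right (hC0 n).le (hC n₀)
        · rw [hm, h]
          exact le_mul_of_one_le_left (hC0 n₀).le (hC n)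
      have hmn : 1 / ((m : ℝ) + 1) ≤ 1 / ((n : ℝ) + 1) :=
        one_div_le_one_div_of_le (by positivity) (by
          have : (n : ℝ) ≤ m := by exact_mod_cast le_max_left _ _
          linarith)
      have hmε : 1 / ((m : ℝ) + 1) ≤ ε :=
        (one_div_le_one_div_of_le (by positivity) (by
          have : (n₀ : ℝ) ≤ m := by exact_mod_cast le_max_right _ _
          linarith)).trans hn₀.le
      have hexp : (h + 1 / ((m : ℝ) + 1)) * |y + y'| ≤
          (h + 1 / ((n : ℝ) + 1)) * |y| + (h + ε) * |y'| := by
        calc (h + 1 / ((m : ℝ) + 1)) * |y + y'|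
            ≤ (h + 1 / ((m : ℝ) + 1)) * (|y| + |y'|) := by
              gcongr
              exact abs_add_le y y'
          _ ≤ _ := by
              rw [mul_add]
              gcongr
      calc w m (y + y') ≤ (C n * C n₀) *
            Real.exp ((h + 1 / ((n : ℝ) + 1)) * |y| + (h + ε) * |y'|) := by
            simp only [w]
            have := (mul_pos (hC0 n) (hC0 n₀)).le
            gcongr
        _ = _ := by
            simp only [w]
            rw [Real.exp_add]
            ring
    have h3 : w n y * ‖NormedSpace.exp ((Complex.I * y') • L) x ⟨n, y, k⟩‖ ≤
        w n y * (C n₀ * Real.exp ((h + ε) * |y'|) * ‖x‖) := by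
      rw [h1, ← mul_assoc]
      exact mul_le_mul h2 (x.norm_coe_le_norm _) (norm_nonneg _)
        (mul_nonneg (hw _ _).le (mul_nonneg (hC0 _).le (Real.exp_pos _).le))
    exact le_of_mul_le_mul_left h3 (hw n y)
  obtain ⟨F, hF, hF'⟩ := exists_generatorBoundedSpace L V
    ((w 0 0 : ℂ) • BoundedContinuousFunction.evalCLM ℂ (⟨0, 0, 0⟩ : WeightIndex)) hh hgrow
  refine ⟨F, ?_, hF'⟩
  convert hF using 2 with t
  have := hexpV t 0 0 0
  rw [Complex.ofReal_zero, mul_zero, zero_add, pow_zero, div_one] at this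
  exact this.symm

/-! ### Growth of operator exponentials from the spectrum. -/

section Growth

variable {X : Type*} [NormedAddCommGroup X] [NormedSpace ℂ X] [CompleteSpace X]

theorem norm_pow_apply_le {X : Type*} [NormedAddCommGroup X] [NormedSpace ℂ X] (A : X →L[ℂ] X)
    (n : ℕ) (x : X) : ‖(A ^ n) x‖ ≤ ‖A‖ ^ n * ‖x‖ := by
  refine ((A ^ n).le_opNorm x).trans ?_
  gcongr
  rcases n.eq_zero_or_pos with rfl | hn
  · rw [pow_zero, pow_zero]
    exact ContinuousLinearMap.norm_id_le
  · exact norm_pow_le' A hn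

theorem norm_exp_apply_le (A : X →L[ℂ] X) (x : X) :
    ‖NormedSpace.exp A x‖ ≤ Real.exp ‖A‖ * ‖x‖ := by
  have h1 := NormedSpace.exp_series_hasSum_exp' (𝕂 := ℝ) ‖A‖
  rw [← Real.exp_eq_exp_ℝ] at h1
  refine (hasSum_exp_apply A x).norm_le_of_bounded (h1.mul_right ‖x‖) fun n => ?_
  rw [norm_smul, norm_inv, Complex.norm_natCast, smul_eq_mul, mul_assoc]
  gcongr
  exact norm_pow_apply_le A n x

/-- The growth bound of the semigroup `exp (tA)` is the spectral bound of `A`. -/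
theorem exists_norm_exp_smul_le {A : X →L[ℂ] X} {c : ℝ} (h : ∀ z ∈ spectrum ℂ A, z.re < c) :
    ∃ C, ∀ t : ℝ, 0 ≤ t → ‖NormedSpace.exp ((t : ℂ) • A)‖ ≤ C * Real.exp (c * t) := by
  rcases subsingleton_or_nontrivial (X →L[ℂ] X) with hs | hnt
  · refine ⟨0, fun t _ => ?_⟩
    rw [Subsingleton.elim (NormedSpace.exp ((t : ℂ) • A)) 0, norm_zero, zero_mul]
  -- By spectral mapping the spectrum of `exp A` lies in the open disc of radius `exp c`; Gelfand's
  -- formula then bounds its large powers.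
  have hρ : spectralRadius ℂ (NormedSpace.exp A) < ENNReal.ofReal (Real.exp c) := by
    refine spectrum.spectralRadius_lt_of_forall_lt _ fun z hz => ?_
    obtain ⟨w, hw, rfl⟩ := exists_mem_spectrum_exp_eq hz
    rw [← NNReal.coe_lt_coe, coe_nnnorm, Real.coe_toNNReal _ (Real.exp_pos c).le, Complex.norm_exp]
    exact Real.exp_lt_exp.2 (h w hw)
  have hev := (spectrum.pow_norm_pow_one_div_tendsto_nhds_spectralRadius
    (NormedSpace.exp A)).eventually (gt_mem_nhds hρ)
  obtain ⟨N, hN⟩ := eventually_atTop.1 (hev.and (eventually_gt_atTop 0))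
  have hlarge : ∀ n ≥ N, ‖NormedSpace.exp A ^ n‖ ≤ Real.exp c ^ n := by
    intro n hn
    obtain ⟨h1, h2⟩ := hN n hn
    have h3 := (ENNReal.ofReal_lt_ofReal_iff (Real.exp_pos c)).1 h1
    have h4 := pow_le_pow_left₀ (by positivity) h3.le n
    rwa [one_div, Real.rpow_inv_natCast_pow (norm_nonneg _) h2.ne'] at h4
  set C₁ : ℝ := 1 + ∑ i ∈ Finset.range N, ‖NormedSpace.exp A ^ i‖ / Real.exp c ^ i with hC₁
  have hC₁1 : 1 ≤ C₁ := le_add_of_nonneg_right (Finset.sum_nonneg fun i _ => by positivity)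
  have hall : ∀ n, ‖NormedSpace.exp A ^ n‖ ≤ C₁ * Real.exp c ^ n := by
    intro n
    rcases lt_or_ge n N with hn | hn
    · rw [← div_le_iff₀ (by positivity)]
      have := Finset.single_le_sum (f := fun i => ‖NormedSpace.exp A ^ i‖ / Real.exp c ^ i)
        (fun i _ => by positivity) (Finset.mem_range.2 hn)
      exact this.trans (by rw [hC₁]; linarith)
    · exact (hlarge n hn).trans (le_mul_of_one_le_left (by positivity) hC₁1)
  obtain ⟨K, hK⟩ := (isCompact_Icc (a := (0 : ℝ)) (b := 1)).exists_bound_of_continuousOn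
    (f := fun s : ℝ => NormedSpace.exp ((s : ℂ) • A))
    ((continuous_exp_smul A).comp Complex.continuous_ofReal).continuousOn
  have hK0 : 0 ≤ K := (norm_nonneg _).trans (hK 0 ⟨le_rfl, zero_le_one⟩)
  -- `C₁` serves the integer part of `t`, `K` the fractional part, and `exp |c|` replaces `c ⌊t⌋` by
  -- `c t` whatever the sign of `c`.
  refine ⟨C₁ * K * Real.exp |c|, fun t ht => ?_⟩
  set n := ⌊t⌋₊ with hn
  have hs : t - n ∈ Set.Icc (0 : ℝ) 1 :=
    ⟨sub_nonneg.2 (Nat.floor_le ht), by linarith [Nat.lt_floor_add_one t]⟩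
  have h1 : NormedSpace.exp ((t : ℂ) • A) =
      NormedSpace.exp A ^ n * NormedSpace.exp (((t - n : ℝ) : ℂ) • A) := by
    rw [← exp_nsmul_complex, ← exp_add_smul]
    congr 2
    push_cast
    ring
  have h2 : Real.exp c ^ n ≤ Real.exp |c| * Real.exp (c * t) := by
    rw [← Real.exp_nat_mul, ← Real.exp_add]
    refine Real.exp_le_exp.2 ?_
    have h3 : -(c * (t - n)) ≤ |c| :=
      calc -(c * (t - n)) ≤ |c * (t - n)| := neg_le_abs _
        _ = |c| * (t - n) := by rw [abs_mul, abs_of_nonneg hs.1]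
        _ ≤ |c| * 1 := by gcongr; exact hs.2
        _ = |c| := mul_one _
    linarith
  rw [h1]
  calc _ ≤ ‖NormedSpace.exp A ^ n‖ * ‖NormedSpace.exp (((t - n : ℝ) : ℂ) • A)‖ := norm_mul_le _ _
    _ ≤ (C₁ * (Real.exp |c| * Real.exp (c * t))) * K := by
        gcongr
        · exact (hall n).trans (by gcongr)
        · exact hK _ hs
    _ = _ := by ring

theorem exists_norm_exp_I_mul_smul_le {A : X →L[ℂ] X} {c : ℝ}
    (h : ∀ z ∈ spectrum ℂ A, |z.im| < c) :
    ∃ C, ∀ y : ℝ, ‖NormedSpace.exp ((Complex.I * y) • A)‖ ≤ C * Real.exp (c * |y|) := by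
  have hspec : ∀ u : ℂˣ, ∀ z ∈ spectrum ℂ ((u : ℂ) • A), ∃ w ∈ spectrum ℂ A, (u : ℂ) * w = z := by
    intro u z hz
    rw [← Units.smul_def, spectrum.unit_smul_eq_smul] at hz
    exact hz
  obtain ⟨C₁, hC₁⟩ := exists_norm_exp_smul_le (A := Complex.I • A) (c := c) fun z hz => by
    obtain ⟨w, hw, rfl⟩ := hspec (Units.mk0 _ Complex.I_ne_zero) z hz
    simpa using (neg_le_abs w.im).trans_lt (h w hw)
  obtain ⟨C₂, hC₂⟩ := exists_norm_exp_smul_le (A := (-Complex.I) • A) (c := c) fun z hz => by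
    obtain ⟨w, hw, rfl⟩ := hspec (Units.mk0 _ (neg_ne_zero.2 Complex.I_ne_zero)) z hz
    simpa using (le_abs_self w.im).trans_lt (h w hw)
  refine ⟨max C₁ C₂, fun y => ?_⟩
  rcases le_total 0 y with hy | hy
  · have h1 := hC₁ y hy
    rw [smul_smul, mul_comm] at h1
    rw [abs_of_nonneg hy]
    exact h1.trans (by gcongr; exact le_max_left _ _)
  · have h1 := hC₂ (-y) (neg_nonneg.2 hy)
    rw [smul_smul, Complex.ofReal_neg, neg_mul_neg, mul_comm] at h1
    rw [abs_of_nonpos hy]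
    exact h1.trans (by gcongr; exact le_max_right _ _)

end Growth

/-! ### Phragmén–Lindelöf and Cauchy estimates. -/

section PhragmenLindelof

open Complex Bornology

theorem isBigO_mul_exp_of_norm_le {G : ℂ → ℂ} {K M : ℝ} (hK : 0 ≤ K)
    (hG : ∀ z, ‖G z‖ ≤ K * Real.exp (M * ‖z‖)) (α : ℂ) (l : Filter ℂ) :
    ∃ c < (2 : ℝ), ∃ B, (fun z => G z * exp (α * z)) =O[l] fun z => Real.exp (B * ‖z‖ ^ c) := by
  refine ⟨1, one_lt_two, M + ‖α‖, Asymptotics.IsBigO.of_bound K (Eventually.of_forall fun z => ?_)⟩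
  rw [Real.rpow_one, norm_mul, Real.norm_of_nonneg (Real.exp_pos _).le, add_mul, Real.exp_add,
    ← mul_assoc]
  refine mul_le_mul (hG z) ?_ (norm_nonneg _) (by positivity)
  rw [norm_exp, Real.exp_le_exp]
  exact ((re_le_norm _).trans (norm_mul_le _ _))

/-- An entire function of exponential type `M` which grows at most like `exp (c |y|)` on the
imaginary axis grows at most like `exp (M |x| + c |y|)` in the plane. -/
theorem norm_le_of_exponential_type {G : ℂ → ℂ} (hG : Differentiable ℂ G) {K M c : ℝ}
    (hbound : ∀ z, ‖G z‖ ≤ K * Real.exp (M * ‖z‖))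
    (him : ∀ y : ℝ, ‖G (y * I)‖ ≤ K * Real.exp (c * |y|)) (z : ℂ) :
    ‖G z‖ ≤ K * Real.exp (M * |z.re| + c * |z.im|) := by
  have hK : 0 ≤ K := by
    have := (norm_nonneg _).trans (him 0)
    simpa using this
  have hdiff : ∀ α : ℂ, Differentiable ℂ fun z => G z * exp (α * z) := fun α => by fun_prop
  have hnorm : ∀ (α z : ℂ), ‖G z * exp (α * z)‖ = ‖G z‖ * Real.exp (α.re * z.re - α.im * z.im) :=
    fun α z => by rw [norm_mul, norm_exp, mul_re]
  have hre : ∀ (α : ℂ) (x : ℝ), α.re * x ≤ -(M * |x|) → ‖G x * exp (α * x)‖ ≤ K := by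
    intro α x hx
    rw [hnorm, ofReal_re, ofReal_im, mul_zero, sub_zero]
    refine (mul_le_mul (hbound x) (Real.exp_le_exp.2 hx) (Real.exp_pos _).le
      (by positivity)).trans_eq ?_
    rw [norm_real, Real.norm_eq_abs, mul_assoc, ← Real.exp_add, add_neg_cancel, Real.exp_zero,
      mul_one]
  have him' : ∀ (α : ℂ) (y : ℝ), -(α.im * y) ≤ -(c * |y|) →
      ‖G (y * I) * exp (α * (y * I))‖ ≤ K := by
    intro α y hy
    rw [hnorm]
    have h1 : α.re * ((y : ℂ) * I).re - α.im * ((y : ℂ) * I).im = -(α.im * y) := by simp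
    rw [h1]
    refine (mul_le_mul (him y) (Real.exp_le_exp.2 hy) (Real.exp_pos _).le
      (by positivity)).trans_eq ?_
    rw [mul_assoc, ← Real.exp_add, add_neg_cancel, Real.exp_zero, mul_one]
  have hconcl : ∀ α : ℂ, ‖G z * exp (α * z)‖ ≤ K →
      α.re * z.re - α.im * z.im = -(M * |z.re| + c * |z.im|) →
      ‖G z‖ ≤ K * Real.exp (M * |z.re| + c * |z.im|) := by
    intro α h1 h2
    rw [hnorm, h2, Real.exp_neg] at h1
    rwa [← div_eq_mul_inv, div_le_iff₀ (Real.exp_pos _)] at h1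
  -- In each quadrant the signs in `α` are chosen so that `|exp (α z)| = exp (-M |x| - c |y|)`; the
  -- product is then bounded by `K` on both boundary rays.
  rcases le_total 0 z.re with hx | hx <;> rcases le_total 0 z.im with hy | hy
  · refine hconcl ⟨-M, c⟩ (PhragmenLindelof.quadrant_I
      (f := fun z => G z * exp (⟨-M, c⟩ * z)) (hdiff _).diffContOnCl
      (isBigO_mul_exp_of_norm_le hK hbound _ _) (fun x hx => hre _ x ?_) (fun y hy => him' _ y ?_)
      hx hy) ?_
    · simp [abs_of_nonneg hx]
    · simp [abs_of_nonneg hy]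
    · rw [abs_of_nonneg hx, abs_of_nonneg hy]; ring
  · refine hconcl ⟨-M, -c⟩ (PhragmenLindelof.quadrant_IV
      (f := fun z => G z * exp (⟨-M, -c⟩ * z)) (hdiff _).diffContOnCl
      (isBigO_mul_exp_of_norm_le hK hbound _ _) (fun x hx => hre _ x ?_) (fun y hy => him' _ y ?_)
      hx hy) ?_
    · simp [abs_of_nonneg hx]
    · simp [abs_of_nonpos hy]
    · rw [abs_of_nonneg hx, abs_of_nonpos hy]; ring
  · refine hconcl ⟨M, c⟩ (PhragmenLindelof.quadrant_II
      (f := fun z => G z * exp (⟨M, c⟩ * z)) (hdiff _).diffContOnCl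
      (isBigO_mul_exp_of_norm_le hK hbound _ _) (fun x hx => hre _ x ?_) (fun y hy => him' _ y ?_)
      hx hy) ?_
    · simp [abs_of_nonpos hx]
    · simp [abs_of_nonneg hy]
    · rw [abs_of_nonpos hx, abs_of_nonneg hy]; ring
  · refine hconcl ⟨M, -c⟩ (PhragmenLindelof.quadrant_III
      (f := fun z => G z * exp (⟨M, -c⟩ * z)) (hdiff _).diffContOnCl
      (isBigO_mul_exp_of_norm_le hK hbound _ _) (fun x hx => hre _ x ?_) (fun y hy => him' _ y ?_)
      hx hy) ?_
    · simp [abs_of_nonpos hx]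
    · simp [abs_of_nonpos hy]
    · rw [abs_of_nonpos hx, abs_of_nonpos hy]; ring

/-- Cauchy's estimate on the circle of radius `k + 1` about `iy`: as `k! ≤ (k + 1) ^ k`, the
factorial is absorbed and the bound is geometric in `k`. -/
theorem norm_iteratedDeriv_le_of_exponential_type {G : ℂ → ℂ} (hG : Differentiable ℂ G)
    {K M c : ℝ} (hM : 0 ≤ M) (hc : 0 ≤ c)
    (hbound : ∀ z, ‖G z‖ ≤ K * Real.exp (M * |z.re| + c * |z.im|)) (k : ℕ) (y : ℝ) :
    ‖iteratedDeriv k G (I * y)‖ ≤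
      K * Real.exp (M + c) * Real.exp (M + c) ^ k * Real.exp (c * |y|) := by
  have hK : 0 ≤ K := by
    have := (norm_nonneg _).trans (hbound 0)
    simpa using this
  have hsphere : ∀ z ∈ Metric.sphere (I * (y : ℂ)) (k + 1 : ℝ),
      ‖G z‖ ≤ K * Real.exp ((M + c) * (k + 1) + c * |y|) := by
    intro z hz
    refine (hbound z).trans (mul_le_mul_of_nonneg_left (Real.exp_le_exp.2 ?_) hK)
    rw [mem_sphere_iff_norm] at hz
    have h1 : |z.re| ≤ k + 1 := by
      have := abs_re_le_norm (z - I * y)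
      rw [hz] at this
      simpa using this
    have h2 : |z.im| ≤ |y| + (k + 1) := by
      have := abs_im_le_norm (z - I * y)
      rw [hz] at this
      have h3 : |z.im - y| ≤ k + 1 := by simpa using this
      calc |z.im| = |y + (z.im - y)| := by ring_nf
        _ ≤ |y| + |z.im - y| := abs_add_le _ _
        _ ≤ _ := by gcongr
    calc M * |z.re| + c * |z.im| ≤ M * (k + 1) + c * (|y| + (k + 1)) := by gcongr
      _ = _ := by ring
  have h1 := norm_iteratedDeriv_le_of_forall_mem_sphere_norm_le k
    (show (0 : ℝ) < k + 1 by positivity) hG.diffContOnCl hsphere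
  refine h1.trans ?_
  rw [div_le_iff₀ (by positivity)]
  have h2 : (k.factorial : ℝ) ≤ (k + 1 : ℝ) ^ k := by
    exact_mod_cast (Nat.factorial_le_pow k).trans (Nat.pow_le_pow_left k.le_succ k)
  rw [Real.exp_add, mul_comm (M + c), ← Nat.cast_succ, Real.exp_nat_mul, pow_succ]
  rw [← Nat.cast_succ] at h2
  calc _ ≤ ((k.succ : ℕ) : ℝ) ^ k *
        (K * (Real.exp (M + c) ^ k * Real.exp (M + c) * Real.exp (c * |y|))) := by gcongr
    _ = _ := by ring

end PhragmenLindelof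

/-! ### Entire extensions of signals and attainment of the minimum. -/

namespace GeneratorBoundedSpace

variable (F : GeneratorBoundedSpace)

/-- The extension of a signal to an entire function. -/
noncomputable def extension (f : F.E) (z : ℂ) : ℂ := F.evalZero (NormedSpace.exp (z • F.L) f)

theorem extension_ofReal (f : F.E) (t : ℝ) : F.extension f t = F.sig f t :=
  (F.sig_eq_evalZero f t).symm

theorem hasDerivAt_extension (f : F.E) (z : ℂ) :
    HasDerivAt (F.extension f) (F.extension (F.L f) z) z := by
  have h1 := hasDerivAt_exp_smul_const (𝕂 := ℂ) F.L z
  exact (F.evalZero ∘L (ContinuousLinearMap.apply ℂ F.E f)).hasFDerivAt.comp_hasDerivAt z h1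

theorem differentiable_extension (f : F.E) : Differentiable ℂ (F.extension f) :=
  fun z => (F.hasDerivAt_extension f z).differentiableAt

theorem iteratedDeriv_extension (f : F.E) (k : ℕ) :
    iteratedDeriv k (F.extension f) = F.extension ((F.L ^ k) f) := by
  induction k with
  | zero => simp
  | succ k ih =>
    rw [iteratedDeriv_succ, ih, pow_succ', mul_apply_eq_comp]
    exact funext fun z => (F.hasDerivAt_extension _ z).deriv

theorem hasSum_extension_pow (f : F.E) (k : ℕ) (s z : ℂ) :
    HasSum (fun j : ℕ => ((j.factorial : ℂ)⁻¹ * z ^ j) * F.extension ((F.L ^ (k + j)) f) s)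
      (F.extension ((F.L ^ k) f) (s + z)) := by
  have h1 := (hasSum_exp_apply (z • F.L) ((F.L ^ k) f)).mapL
    (F.evalZero ∘L NormedSpace.exp (s • F.L))
  rw [extension, exp_add_smul_apply]
  refine h1.congr_fun fun j => ?_
  rw [smul_pow, smul_apply, map_smul, map_smul, add_comm k j, pow_add, mul_apply_eq_comp,
    smul_eq_mul, smul_eq_mul, mul_assoc]
  rfl

theorem norm_extension_le (f : F.E) (z : ℂ) :
    ‖F.extension f z‖ ≤ ‖F.evalZero‖ * ‖f‖ * Real.exp (‖F.L‖ * ‖z‖) := by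
  refine (F.evalZero.le_opNorm _).trans ?_
  rw [mul_assoc]
  gcongr
  refine (norm_exp_apply_le _ f).trans ?_
  rw [norm_smul, mul_comm, mul_comm ‖z‖]

theorem exists_norm_extension_le (f : F.E) {c : ℝ} (hc : F.maxIm < c) :
    ∃ K, ∀ y : ℝ, ‖F.extension f (y * Complex.I)‖ ≤ K * Real.exp (c * |y|) := by
  obtain ⟨C, hC⟩ := exists_norm_exp_I_mul_smul_le (A := F.L) (c := c) fun z hz =>
    (F.abs_im_le_maxIm hz).trans_lt hc
  refine ⟨‖F.evalZero‖ * C * ‖f‖, fun y => ?_⟩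
  refine (F.evalZero.le_opNorm _).trans ?_
  rw [mul_assoc, mul_assoc]
  gcongr
  refine (ContinuousLinearMap.le_opNorm _ f).trans ?_
  rw [mul_comm (y : ℂ), mul_comm ‖f‖, ← mul_assoc]
  gcongr
  exact hC y

end GeneratorBoundedSpace

/-- By the identity theorem the extension depends on the signal alone, so growth bounds obtained in
different spaces apply to one function. -/
theorem extension_eq_extension {F F' : GeneratorBoundedSpace} {f : F.E} {f' : F'.E}
    (h : F.sig f = F'.sig f') : F.extension f = F'.extension f' := by
  refine AnalyticOnNhd.eq_of_frequently_eq (z₀ := 0)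
    (fun z _ => (F.differentiable_extension f).analyticAt z)
    (fun z _ => (F'.differentiable_extension f').analyticAt z) ?_
  have h1 : Tendsto (fun t : ℝ => (t : ℂ)) (𝓝[≠] 0) (𝓝[≠] 0) := by
    refine tendsto_nhdsWithin_iff.2 ⟨?_, ?_⟩
    · simpa using (Complex.continuous_ofReal.tendsto 0).mono_left nhdsWithin_le_nhds
    · filter_upwards [self_mem_nhdsWithin] with t ht
      exact Complex.ofReal_ne_zero.2 ht
  refine h1.frequently (Eventually.of_forall fun t => ?_).frequently
  rw [F.extension_ofReal, F'.extension_ofReal, h]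

theorem bddBelow_freqSet (g : ℝ → ℂ) : BddBelow (freqSet g) :=
  ⟨0, by rintro _ ⟨F, _, rfl⟩; exact F.maxIm_nonneg⟩

theorem GeneratorBoundedSpace.minFreq_le {F : GeneratorBoundedSpace} {g : ℝ → ℂ}
    (h : F.Contains g) : minFreq g ≤ F.maxIm :=
  csInf_le (bddBelow_freqSet g) ⟨F, h, rfl⟩

theorem minFreq_nonneg (g : ℝ → ℂ) : 0 ≤ minFreq g :=
  Real.sInf_nonneg <| by rintro _ ⟨F, _, rfl⟩; exact F.maxIm_nonneg

/-- The infimum in the definition of `minFreq` is attained. -/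
theorem isLeast_minFreq {g : ℝ → ℂ} (hg : ∃ F : GeneratorBoundedSpace, F.Contains g) :
    IsLeast (freqSet g) (minFreq g) := by
  obtain ⟨F, f, hf⟩ := hg
  set h := minFreq g with hh
  have hh0 : 0 ≤ h := minFreq_nonneg g
  set M := ‖F.L‖ with hM
  -- The base of the derivative bounds must not depend on `n`: the type `M` comes from the fixed
  -- space `F`, and every `c = h + 1/(n+1)` is at most `h + 1`.
  set A := Real.exp (M + (h + 1)) with hA
  have hbound : ∀ n : ℕ, ∃ C, 1 ≤ C ∧ ∀ k (y : ℝ), ‖F.extension ((F.L ^ k) f) (Complex.I * y)‖ ≤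
      C * A ^ k * Real.exp ((h + 1 / ((n : ℝ) + 1)) * |y|) := by
    intro n
    set c := h + 1 / ((n : ℝ) + 1) with hc
    have hn0 : 0 < 1 / ((n : ℝ) + 1) := by positivity
    obtain ⟨_, ⟨F', ⟨f', hf'⟩, rfl⟩, hlt⟩ := exists_lt_of_csInf_lt
      (⟨_, F, ⟨f, hf⟩, rfl⟩ : (freqSet g).Nonempty) (show sInf (freqSet g) < c from
        lt_add_of_pos_right h hn0)
    obtain ⟨K₁, hK₁⟩ := F'.exists_norm_extension_le f' hlt
    rw [extension_eq_extension (hf'.trans hf.symm)] at hK₁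
    set K := max K₁ (‖F.evalZero‖ * ‖f‖) with hK
    have hK0 : 0 ≤ K := (by positivity : 0 ≤ ‖F.evalZero‖ * ‖f‖).trans (le_max_right _ _)
    have hc0 : 0 ≤ c := by positivity
    have hc1 : c ≤ h + 1 := by
      have : 1 / ((n : ℝ) + 1) ≤ 1 := by
        rw [div_le_one (by positivity)]
        linarith [n.cast_nonneg (α := ℝ)]
      linarith
    have hgrow := norm_le_of_exponential_type (F.differentiable_extension f) (K := K) (M := M)
      (c := c)
      (fun z => (F.norm_extension_le f z).trans (by gcongr; exact le_max_right _ _))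
      (fun y => (hK₁ y).trans (by gcongr; exact le_max_left _ _))
    refine ⟨max 1 (K * Real.exp (M + c)), le_max_left _ _, fun k y => ?_⟩
    rw [← F.iteratedDeriv_extension]
    refine (norm_iteratedDeriv_le_of_exponential_type (F.differentiable_extension f)
      (norm_nonneg F.L) hc0 hgrow k y).trans ?_
    gcongr
    · exact le_max_right _ _
    · rw [hA]
      gcongr
  choose C hC1 hC using hbound
  obtain ⟨F', hF', hle⟩ := exists_generatorBoundedSpace_of_growth
    (G := fun k => F.extension ((F.L ^ k) f)) hh0 (Real.exp_pos _) hC1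
    (F.hasSum_extension_pow f) hC
  have hg' : (fun t : ℝ => F.extension ((F.L ^ 0) f) t) = g := by
    rw [← hf]
    exact funext fun t => F.extension_ofReal f t
  rw [hg'] at hF'
  exact ⟨⟨F', hF', le_antisymm (GeneratorBoundedSpace.minFreq_le hF') hle⟩,
    fun r ⟨F'', hF'', hr⟩ => hr ▸ GeneratorBoundedSpace.minFreq_le hF''⟩

/-! ### Uniqueness of a signal with given samples. -/

section Sampling

theorem spectrum_prodMap_subset {X Y : Type*} [NormedAddCommGroup X] [NormedSpace ℂ X]
    [NormedAddCommGroup Y] [NormedSpace ℂ Y] (A : X →L[ℂ] X) (B : Y →L[ℂ] Y) :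
    spectrum ℂ (A.prodMap B) ⊆ spectrum ℂ A ∪ spectrum ℂ B := by
  intro z hz
  by_contra hcon
  rw [Set.mem_union, not_or, spectrum.notMem_iff, spectrum.notMem_iff] at hcon
  obtain ⟨⟨u, hu⟩, ⟨w, hw⟩⟩ := hcon
  refine hz ⟨⟨(u : X →L[ℂ] X).prodMap (w : Y →L[ℂ] Y),
    ((u⁻¹ : (X →L[ℂ] X)ˣ) : X →L[ℂ] X).prodMap ((w⁻¹ : (Y →L[ℂ] Y)ˣ) : Y →L[ℂ] Y), ?_, ?_⟩, ?_⟩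
  · exact ContinuousLinearMap.ext fun p =>
      Prod.ext (DFunLike.congr_fun u.mul_inv p.1) (DFunLike.congr_fun w.mul_inv p.2)
  · exact ContinuousLinearMap.ext fun p =>
      Prod.ext (DFunLike.congr_fun u.inv_mul p.1) (DFunLike.congr_fun w.inv_mul p.2)
  · exact ContinuousLinearMap.ext fun p =>
      Prod.ext (DFunLike.congr_fun hu p.1) (DFunLike.congr_fun hw p.2)

variable {X : Type*} [NormedAddCommGroup X] [NormedSpace ℂ X] [CompleteSpace X]

/-- If `b` has spectrum in the open strip `|Im z| < π`, then a functional that vanishes on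
`exp (k b) v` for every natural number `k` vanishes on `exp (s b) v` for every `s`. -/
theorem forall_apply_exp_smul_eq_zero {b : X →L[ℂ] X} (hb : ∀ z ∈ spectrum ℂ b, |z.im| < Real.pi)
    (ψ : X →L[ℂ] ℂ) (v : X) (h : ∀ k : ℕ, ψ (NormedSpace.exp ((k : ℂ) • b) v) = 0) (s : ℂ) :
    ψ (NormedSpace.exp (s • b) v) = 0 := by
  -- The states whose samples all vanish; dropping the first sample shows that `N` is invariant
  -- under `exp b`, hence under `b`.
  let N : Submodule ℂ X := ⨅ k : ℕ, (ψ ∘L NormedSpace.exp ((k : ℂ) • b)).ker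
  have hN : ∀ x, x ∈ N ↔ ∀ k : ℕ, ψ (NormedSpace.exp ((k : ℂ) • b) x) = 0 := fun x => by
    simp [N, Submodule.mem_iInf]
  have hNc : IsClosed (N : Set X) := by
    have : (N : Set X) = ⋂ k : ℕ, ((ψ ∘L NormedSpace.exp ((k : ℂ) • b)).ker : Set X) := by
      simp only [N, Submodule.coe_iInf]
    rw [this]
    exact isClosed_iInter fun t => ContinuousLinearMap.isClosed_ker _
  have hexp : ∀ x ∈ N, NormedSpace.exp b x ∈ N := fun x hx => by
    rw [hN] at hx ⊢
    intro k
    have h1 := exp_add_smul_apply b k 1 x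
    rw [one_smul] at h1
    rw [← h1]
    exact_mod_cast hx (k + 1)
  have hbN := mapsTo_of_mapsTo_exp hb hNc hexp
  have hpow : ∀ n : ℕ, (b ^ n) v ∈ N := fun n => by
    induction n with
    | zero => exact (hN v).2 h
    | succ n ih =>
      rw [pow_succ', mul_apply_eq_comp]
      exact hbN _ ih
  have hmem : NormedSpace.exp (s • b) v ∈ N := by
    refine hNc.mem_of_tendsto (hasSum_exp_apply (s • b) v) (Eventually.of_forall fun t => ?_)
    refine N.sum_mem fun n _ => N.smul_mem _ ?_
    rw [smul_pow, smul_apply]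
    exact N.smul_mem _ (hpow n)
  simpa using (hN _).1 hmem 0

end Sampling

/-- A signal is determined by its samples at a rate exceeding twice its largest frequency. -/
theorem eq_of_forall_sample_eq {F F' : GeneratorBoundedSpace} {f : F.E} {f' : F'.E} {T : ℝ}
    (hT : 0 < T) (hF : F.maxIm < Real.pi / T) (hF' : F'.maxIm < Real.pi / T)
    (h : ∀ k : ℕ, F.sig f (k * T) = F'.sig f' (k * T)) : F.sig f = F'.sig f' := by
  -- In the product system the difference of the two signals is observed by a single functional, and
  -- the spectrum of `B` stays in the strip.
  let B := ((T : ℂ) • F.L).prodMap ((T : ℂ) • F'.L)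
  let ψ : F.E × F'.E →L[ℂ] ℂ :=
    F.evalZero ∘L ContinuousLinearMap.fst ℂ _ _ - F'.evalZero ∘L ContinuousLinearMap.snd ℂ _ _
  have hT' : (T : ℂ) ≠ 0 := by exact_mod_cast hT.ne'
  have hψ : ∀ s : ℝ, ψ (NormedSpace.exp ((s : ℂ) • B) (f, f')) =
      F.sig f (s * T) - F'.sig f' (s * T) := fun s => by
    have h1 : (NormedSpace.exp ((s : ℂ) • B) (f, f')).1 =
        NormedSpace.exp ((s : ℂ) • ((T : ℂ) • F.L)) f :=
      map_exp_smul_apply_of_intertwining (ContinuousLinearMap.fst ℂ F.E F'.E) (fun _ => rfl) _ _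
    have h2 : (NormedSpace.exp ((s : ℂ) • B) (f, f')).2 =
        NormedSpace.exp ((s : ℂ) • ((T : ℂ) • F'.L)) f' :=
      map_exp_smul_apply_of_intertwining (ContinuousLinearMap.snd ℂ F.E F'.E) (fun _ => rfl) _ _
    change F.evalZero (NormedSpace.exp ((s : ℂ) • B) (f, f')).1 -
      F'.evalZero (NormedSpace.exp ((s : ℂ) • B) (f, f')).2 = _
    rw [h1, h2, smul_smul, smul_smul, ← Complex.ofReal_mul, ← F.sig_eq_evalZero,
      ← F'.sig_eq_evalZero]
  have hB : ∀ z ∈ spectrum ℂ B, |z.im| < Real.pi := fun z hz => by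
    rcases spectrum_prodMap_subset _ _ hz with hz | hz
    · exact F.abs_im_lt_of_mem_spectrum_smul hT hF hz
    · exact F'.abs_im_lt_of_mem_spectrum_smul hT hF' hz
  have hzero := forall_apply_exp_smul_eq_zero hB ψ (f, f') fun k => by
    have := hψ k
    rwa [h, sub_self, Complex.ofReal_natCast] at this
  funext t
  have h1 := hψ (t / T)
  rw [hzero, div_mul_cancel₀ _ hT.ne'] at h1
  exact sub_eq_zero.1 h1.symm

/-! ### Signals as superpositions of exponentials over a circle. -/

section CauchyRepresentation

open Complex MeasureTheory

theorem integral_inv_pow_mul_exp_circleMap {R : ℝ} (hR : 0 < R) (n : ℕ) (t : ℂ) :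
    ∫ θ in (0 : ℝ)..2 * Real.pi, ((circleMap 0 R θ) ^ n)⁻¹ * exp (t * circleMap 0 R θ) =
      2 * Real.pi * ((n.factorial : ℂ)⁻¹ * t ^ n) := by
  have h1 := DiffContOnCl.circleIntegral_one_div_sub_center_pow_smul (c := 0)
    (f := fun z => exp (t * z)) hR n (Differentiable.diffContOnCl (by fun_prop))
  rw [iteratedDeriv_cexp_const_mul, circleIntegral] at h1
  have h2 : ∀ θ : ℝ, deriv (circleMap 0 R) θ • (1 / (circleMap 0 R θ - 0) ^ (n + 1)) •
      exp (t * circleMap 0 R θ) = I * (((circleMap 0 R θ) ^ n)⁻¹ * exp (t * circleMap 0 R θ)) := by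
    intro θ
    have h0 : circleMap 0 R θ ≠ 0 := circleMap_ne_center hR.ne'
    rw [deriv_circleMap, sub_zero, smul_eq_mul, smul_eq_mul, pow_succ]
    field_simp
  simp only [h2] at h1
  rw [intervalIntegral.integral_const_mul] at h1
  refine mul_left_cancel₀ I_ne_zero (h1.trans ?_)
  simp only [smul_eq_mul, mul_zero, exp_zero]
  field_simp

/-- An entire function of exponential type, given by its Taylor coefficients, is a superposition of
exponentials with frequencies on a circle. -/
theorem exists_integral_exp_circleMap {a : ℕ → ℂ} {K M R : ℝ} (hM : 0 ≤ M) (hMR : M < R)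
    (ha : ∀ n, ‖a n‖ ≤ K * M ^ n) :
    ∃ β : ℝ → ℂ, Continuous β ∧ ∀ t : ℂ, HasSum (fun n : ℕ => (n.factorial : ℂ)⁻¹ * t ^ n * a n)
      (∫ θ in (0 : ℝ)..2 * Real.pi, β θ * exp (t * circleMap 0 R θ)) := by
  have hR : 0 < R := hM.trans_lt hMR
  have hcm : Continuous (circleMap 0 R) := continuous_circleMap 0 R
  have hne : ∀ θ, circleMap 0 R θ ≠ 0 := fun θ => circleMap_ne_center hR.ne'
  have hnorm : ∀ n θ, ‖a n * ((circleMap 0 R θ) ^ n)⁻¹‖ ≤ K * (M / R) ^ n := by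
    intro n θ
    rw [norm_mul, norm_inv, norm_pow, norm_circleMap_zero, abs_of_pos hR, div_pow,
      ← div_eq_mul_inv, ← mul_div_assoc]
    gcongr
    exact ha n
  have hsum : Summable fun n : ℕ => K * (M / R) ^ n :=
    (summable_geometric_of_lt_one (by positivity) ((div_lt_one hR).2 hMR)).mul_left K
  have hterm : ∀ n, Continuous fun θ => a n * ((circleMap 0 R θ) ^ n)⁻¹ := fun n =>
    continuous_const.mul ((hcm.pow n).inv₀ fun θ => pow_ne_zero n (hne θ))
  -- This is `z` times the Borel transform `∑ a n / z ^ (n + 1)` on `|z| = R`, geometrically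
  -- convergent because `M < R`.
  let β₀ : ℝ → ℂ := fun θ => ∑' n, a n * ((circleMap 0 R θ) ^ n)⁻¹
  have hβ₀ : Continuous β₀ := continuous_tsum hterm hsum hnorm
  refine ⟨fun θ => (2 * Real.pi : ℂ)⁻¹ * β₀ θ, continuous_const.mul hβ₀, fun t => ?_⟩
  have hexp : Continuous fun θ => exp (t * circleMap 0 R θ) := by fun_prop
  have hbd : ∀ θ, ‖exp (t * circleMap 0 R θ)‖ ≤ Real.exp (‖t‖ * R) := fun θ => by
    rw [norm_exp]
    refine Real.exp_le_exp.2 ((re_le_norm _).trans_eq ?_)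
    rw [norm_mul, norm_circleMap_zero, abs_of_pos hR]
  have h1 := intervalIntegral.hasSum_integral_of_dominated_convergence (a := 0)
    (b := 2 * Real.pi) (μ := volume)
    (F := fun n θ => a n * (((circleMap 0 R θ) ^ n)⁻¹ * exp (t * circleMap 0 R θ)))
    (f := fun θ => β₀ θ * exp (t * circleMap 0 R θ))
    (fun n _ => K * (M / R) ^ n * Real.exp (‖t‖ * R))
    (fun n => by
      simp only [← mul_assoc]
      exact ((hterm n).mul hexp).aestronglyMeasurable)
    (fun n => Eventually.of_forall fun θ _ => by
      rw [← mul_assoc, norm_mul]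
      exact mul_le_mul (hnorm n θ) (hbd θ) (norm_nonneg _) ((norm_nonneg _).trans (hnorm n θ)))
    (Eventually.of_forall fun θ _ => hsum.mul_right _)
    intervalIntegrable_const
    (Eventually.of_forall fun θ _ => by
      simp only [← mul_assoc]
      exact (Summable.of_norm_bounded hsum fun n => hnorm n θ).hasSum.mul_right _)
  simp only [intervalIntegral.integral_const_mul, integral_inv_pow_mul_exp_circleMap hR] at h1
  have h2 := h1.mul_left (2 * Real.pi : ℂ)⁻¹
  have hpi : (Real.pi : ℂ) ≠ 0 := by exact_mod_cast Real.pi_ne_zero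
  simp only [mul_assoc, intervalIntegral.integral_const_mul]
  refine h2.congr_fun fun n => ?_
  field_simp

end CauchyRepresentation

/-! ### Folding exponents into the strip. -/

section Rectangle

open Complex MeasureTheory

/-- A closed rectangle, symmetric about `0`. -/
abbrev symmRectangle (R r : ℝ) : Set ℂ := Set.Icc (-R) R ×ℂ Set.Icc (-r) r

instance (R r : ℝ) : CompactSpace (symmRectangle R r) :=
  isCompact_iff_compactSpace.1 (isCompact_Icc.reProdIm isCompact_Icc)

variable {R r : ℝ}

/-- The exponential `z ↦ exp (tz)` on a rectangle. -/
noncomputable def expOnRectangle (R r : ℝ) (t : ℂ) : C(symmRectangle R r, ℂ) where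
  toFun z := exp (t * z)

/-- Superpositions of exponentials with exponents in the strip `|Im z| ≤ r` lie in a
generator-bounded space with frequencies at most `r`. -/
theorem exists_generatorBoundedSpace_rectangle (hr : 0 ≤ r) (φ : C(symmRectangle R r, ℂ) →L[ℂ] ℂ) :
    ∃ F : GeneratorBoundedSpace, F.Contains (fun t => φ (expOnRectangle R r t)) ∧ F.maxIm ≤ r := by
  -- Multiplication by `z`: its exponentials are multiplications by `exp (c z)`, so the growth can
  -- be read off pointwise.
  let L : C(symmRectangle R r, ℂ) →L[ℂ] C(symmRectangle R r, ℂ) :=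
    ContinuousLinearMap.mul ℂ _ ⟨fun z => (z : ℂ), continuous_subtype_val⟩
  have hpow : ∀ (n : ℕ) (x : C(symmRectangle R r, ℂ)) z, (L ^ n) x z = (z : ℂ) ^ n * x z := by
    intro n x z
    induction n with
    | zero => simp
    | succ n ih =>
      rw [pow_succ', pow_succ', mul_assoc, ← ih]
      rfl
  have hexp : ∀ (c : ℂ) (x : C(symmRectangle R r, ℂ)) z,
      NormedSpace.exp (c • L) x z = exp (c * z) * x z := by
    intro c x z
    have h1 := (hasSum_exp_apply (c • L) x).mapL (ContinuousMap.evalCLM ℂ z)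
    have h2 := (NormedSpace.exp_series_hasSum_exp' (𝕂 := ℂ) (c * (z : ℂ))).mul_right (x z)
    rw [← exp_eq_exp_ℂ] at h2
    refine h1.unique (h2.congr_fun fun n => ?_)
    rw [smul_pow]
    simp only [ContinuousMap.evalCLM_apply, smul_apply, ContinuousMap.coe_smul, Pi.smul_apply,
      smul_eq_mul, hpow]
    ring
  obtain ⟨F, hF, hF'⟩ := exists_generatorBoundedSpace L 1 φ hr fun ε hε => ⟨1, fun y x _ => by
    rw [one_mul, ContinuousMap.norm_le _ (by positivity)]
    intro z
    rw [hexp, norm_mul]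
    refine mul_le_mul ?_ (x.norm_coe_le_norm z) (norm_nonneg _) (Real.exp_pos _).le
    rw [norm_exp]
    refine Real.exp_le_exp.2 ?_
    have hz : |(z : ℂ).im| ≤ r := abs_le.2 z.2.2
    calc (I * y * (z : ℂ)).re = -(y * (z : ℂ).im) := by simp
      _ ≤ |y * (z : ℂ).im| := neg_le_abs _
      _ = |(z : ℂ).im| * |y| := by rw [abs_mul, mul_comm]
      _ ≤ (r + ε) * |y| := by gcongr; linarith⟩
  refine ⟨F, ?_, hF'⟩
  convert hF using 3 with t
  ext z
  rw [hexp]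
  simp [expOnRectangle]

/-- Translation of a point by a multiple of `2ri` into the strip `|Im z| ≤ r`. -/
noncomputable def foldStrip (r : ℝ) (z : ℂ) : ℂ := z - (2 * r * round (z.im / (2 * r)) : ℝ) * I

theorem foldStrip_re (r : ℝ) (z : ℂ) : (foldStrip r z).re = z.re := by simp [foldStrip]

theorem abs_foldStrip_im_le (hr : 0 < r) (z : ℂ) : |(foldStrip r z).im| ≤ r := by
  have h1 : (foldStrip r z).im = (2 * r) * (z.im / (2 * r) - round (z.im / (2 * r))) := by
    rw [mul_sub, mul_div_cancel₀ _ (by positivity)]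
    simp [foldStrip]
  rw [h1, abs_mul, abs_of_pos (by positivity : 0 < 2 * r)]
  calc 2 * r * _ ≤ 2 * r * (1 / 2) := by gcongr; exact abs_sub_round _
    _ = r := by ring

/-- Folding is discontinuous, but a measurable curve is enough for integration. -/
theorem measurable_foldStrip (r : ℝ) : Measurable (foldStrip r) := by
  have h1 : Measurable fun z : ℂ => round (z.im / (2 * r)) := by
    simp only [round_eq]
    exact ((measurable_im.div_const _).add_const _).floor
  have h2 : Measurable fun z : ℂ => ((round (z.im / (2 * r)) : ℤ) : ℝ) :=
    (measurable_from_top (f := fun n : ℤ => (n : ℝ))).comp h1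
  exact measurable_id.sub ((measurable_ofReal.comp (h2.const_mul (2 * r))).mul_const I)

/-- For `r = π / T` folding subtracts a multiple of `2πi / T`, which `k T` turns into a multiple of
`2πi`. -/
theorem exp_mul_foldStrip {T : ℝ} (hT : 0 < T) (k : ℤ) (z : ℂ) :
    exp (((k * T : ℝ) : ℂ) * foldStrip (Real.pi / T) z) = exp (((k * T : ℝ) : ℂ) * z) := by
  rw [exp_eq_exp_iff_exists_int]
  refine ⟨-(k * round (z.im / (2 * (Real.pi / T)))), ?_⟩
  have hT' : (T : ℂ) ≠ 0 := by exact_mod_cast hT.ne'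
  rw [foldStrip]
  push_cast
  field_simp
  ring

/-- Integration of a function on a rectangle against a density on a curve in it. -/
noncomputable def integralOnCurve {β : ℝ → ℂ} (hβ : Continuous β) {p : ℝ → symmRectangle R r}
    (hp : Measurable p) : C(symmRectangle R r, ℂ) →L[ℂ] ℂ :=
  have hint : ∀ x : C(symmRectangle R r, ℂ),
      IntervalIntegrable (fun θ => β θ * x (p θ)) volume 0 (2 * Real.pi) := fun x => by
    rw [intervalIntegrable_iff]
    exact (hβ.intervalIntegrable 0 _).def'.mul_bdd
      (x.continuous.measurable.comp hp).aestronglyMeasurable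
      (Eventually.of_forall fun θ => x.norm_coe_le_norm _)
  LinearMap.mkContinuous
    { toFun x := ∫ θ in (0 : ℝ)..2 * Real.pi, β θ * x (p θ)
      map_add' x x' := by
        rw [← intervalIntegral.integral_add (hint x) (hint x')]
        exact intervalIntegral.integral_congr fun θ _ => mul_add _ _ _
      map_smul' c x := by
        rw [RingHom.id_apply, smul_eq_mul, ← intervalIntegral.integral_const_mul]
        exact intervalIntegral.integral_congr fun θ _ => mul_left_comm _ _ _ }
    (∫ θ in (0 : ℝ)..2 * Real.pi, ‖β θ‖) fun x => by
      rw [← intervalIntegral.integral_mul_const]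
      refine intervalIntegral.norm_integral_le_of_norm_le Real.two_pi_pos.le
        (Eventually.of_forall fun θ _ => ?_)
        ((hβ.norm.mul continuous_const).intervalIntegrable _ _)
      rw [norm_mul]
      gcongr
      exact x.norm_coe_le_norm _

end Rectangle

theorem norm_coeff_le (F : GeneratorBoundedSpace) (f : F.E) (n : ℕ) :
    ‖F.evalZero ((F.L ^ n) f)‖ ≤ ‖F.evalZero‖ * ‖f‖ * ‖F.L‖ ^ n := by
  refine (F.evalZero.le_opNorm _).trans ?_
  rw [mul_assoc, mul_comm ‖f‖]
  gcongr
  exact norm_pow_apply_le F.L n f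

/-- Every signal of a generator-bounded space shares its samples of period `T` with a different
signal of frequency at most `π / T`. -/
theorem exists_ne_sample_eq {g : ℝ → ℂ} (hg : ∃ F : GeneratorBoundedSpace, F.Contains g) {T : ℝ}
    (hT : 0 < T) :
    ∃ g' ≠ g, (∀ k : ℤ, g' (k * T) = g (k * T)) ∧
      ∃ F : GeneratorBoundedSpace, F.Contains g' ∧ F.maxIm ≤ Real.pi / T := by
  obtain ⟨F, f, rfl⟩ := hg
  set r := Real.pi / T with hr
  have hr0 : 0 < r := by positivity
  set R := ‖F.L‖ + 1 with hR
  have hR0 : 0 < R := by positivity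
  obtain ⟨β, hβ, hsum⟩ := exists_integral_exp_circleMap (norm_nonneg F.L) (lt_add_one ‖F.L‖)
    (norm_coeff_le F f)
  have hgβ : ∀ t : ℝ, F.sig f t =
      ∫ θ in (0 : ℝ)..2 * Real.pi, β θ * Complex.exp ((t : ℂ) * circleMap 0 R θ) := fun t => by
    rw [← F.extension_ofReal]
    have h1 := F.hasSum_extension_pow f 0 0 t
    simp only [zero_add, pow_zero, one_apply_eq_self] at h1
    refine h1.unique ((hsum t).congr_fun fun n => ?_)
    rw [GeneratorBoundedSpace.extension, zero_smul, NormedSpace.exp_zero, one_apply_eq_self]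
  let p : ℝ → symmRectangle R r := fun θ => ⟨foldStrip r (circleMap 0 R θ), by
    refine ⟨?_, abs_le.1 (abs_foldStrip_im_le hr0 _)⟩
    rw [Set.mem_preimage, foldStrip_re]
    have := Complex.abs_re_le_norm (circleMap 0 R θ)
    rw [norm_circleMap_zero, abs_of_pos hR0] at this
    exact abs_le.1 this⟩
  have hp : Measurable p :=
    ((measurable_foldStrip r).comp (continuous_circleMap 0 R).measurable).subtype_mk
  let zp : symmRectangle R r := ⟨r * Complex.I, by
    constructor <;> simp [hR0.le, hr0.le]⟩
  let zm : symmRectangle R r := ⟨-(r * Complex.I), by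
    constructor <;> simp [hR0.le, hr0.le]⟩
  -- The folded signal might be `g` itself, so `c` times `2i sin (π t / T)` is added, which vanishes
  -- at the samples. The choices `c = 0` and `c = 1` differ at `T / 2`, so some `c` gives a signal
  -- other than `g`.
  let φ : ℂ → C(symmRectangle R r, ℂ) →L[ℂ] ℂ := fun c =>
    integralOnCurve hβ hp + c • (ContinuousMap.evalCLM ℂ zp - ContinuousMap.evalCLM ℂ zm)
  let g' : ℂ → ℝ → ℂ := fun c t => φ c (expOnRectangle R r t)
  have hg' : ∀ c t, g' c t =
      (∫ θ in (0 : ℝ)..2 * Real.pi, β θ * Complex.exp (t * foldStrip r (circleMap 0 R θ))) +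
        c * (Complex.exp (t * (r * Complex.I)) - Complex.exp (-(t * (r * Complex.I)))) := by
    intro c t
    rw [← mul_neg]
    rfl
  have hsample : ∀ c, ∀ k : ℤ, g' c (k * T) = F.sig f (k * T) := by
    intro c k
    have h1 : (((k * T : ℝ) : ℂ)) * (r * Complex.I) = k * (Real.pi * Complex.I) := by
      have hT' : (T : ℂ) ≠ 0 := by exact_mod_cast hT.ne'
      rw [hr]
      push_cast
      field_simp
    have h2 : Complex.exp (k * (Real.pi * Complex.I)) =
        Complex.exp (-(k * (Real.pi * Complex.I))) := by
      rw [Complex.exp_eq_exp_iff_exists_int]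
      exact ⟨k, by ring⟩
    rw [hg', h1, h2, sub_self, mul_zero, add_zero, hgβ]
    refine intervalIntegral.integral_congr fun θ _ => ?_
    rw [hr, exp_mul_foldStrip hT]
  have hne : g' 0 ≠ g' 1 := by
    intro h
    have h1 := congrFun h (T / 2)
    rw [hg', hg', zero_mul, one_mul, add_zero, left_eq_add] at h1
    have h2 : ((T / 2 : ℝ) : ℂ) * (r * Complex.I) = Real.pi / 2 * Complex.I := by
      have hT' : (T : ℂ) ≠ 0 := by exact_mod_cast hT.ne'
      rw [hr]
      push_cast
      field_simp
    rw [h2, Complex.exp_neg, Complex.exp_pi_div_two_mul_I, Complex.inv_I, sub_neg_eq_add] at h1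
    exact Complex.I_ne_zero (add_self_eq_zero.1 h1)
  obtain ⟨c, hc⟩ : ∃ c, g' c ≠ F.sig f := by
    by_contra! hcon
    exact hne ((hcon 0).trans (hcon 1).symm)
  exact ⟨g' c, hc, hsample c, exists_generatorBoundedSpace_rectangle hr0.le (φ c)⟩

/-! ### The sampling theorem. -/

theorem theorem1 (g : ℝ → ℂ) (hg : ∃ F : GeneratorBoundedSpace, F.Contains g)
    (Ts : ℝ≥0) (hTs : 0 < Ts) (ωs : ℝ) (hωs : ωs = 2 * Real.pi / (Ts : ℝ)) :
    -- the minimum over the generator-bounded spaces containing `g` is attained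
    IsLeast (freqSet g) (minFreq g) ∧
    -- the sampling criterion
    (NoAliasing Ts g ↔ ωs > 2 * minFreq g) ∧
    -- below the bound, there is an alias with frequencies at most `ωs / 2`
    (ωs ≤ 2 * minFreq g → ∃ g', IsAlias Ts g g' ∧ minFreq g' ≤ ωs / 2) ∧
    -- recovery of the generator by the principal logarithm, and the reconstruction formula
    (∀ (F : GeneratorBoundedSpace) (f : F.E), F.sig f = g →
      (IsPrincipalLog (F.U Ts) (((Ts : ℝ) : ℂ) • F.L) ↔ ωs > 2 * F.maxIm) ∧
      (ωs > 2 * F.maxIm →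
        (∃! B : F.E →L[ℂ] F.E, IsPrincipalLog (F.U Ts) B) ∧
        principalLog (F.U Ts) = ((Ts : ℝ) : ℂ) • F.L ∧
        ∀ τ : ℝ, g τ =
          F.sig (NormedSpace.exp (((τ / Ts : ℝ) : ℂ) • principalLog (F.U Ts)) f) 0)) := by
  have hT0 : (0 : ℝ) < Ts := hTs
  have hhalf : ωs / 2 = Real.pi / Ts := by rw [hωs]; ring
  have hiff : ∀ m : ℝ, ωs > 2 * m ↔ m < Real.pi / Ts := fun m => by
    rw [← hhalf, lt_div_iff₀ two_pos, mul_comm, gt_iff_lt]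
  have hleast := isLeast_minFreq hg
  have halias : ωs ≤ 2 * minFreq g → ∃ g', IsAlias Ts g g' ∧ minFreq g' ≤ ωs / 2 := fun h => by
    obtain ⟨g', hne, hsample, F, hF, hle⟩ := exists_ne_sample_eq hg hT0
    have h1 : minFreq g' ≤ ωs / 2 :=
      (GeneratorBoundedSpace.minFreq_le hF).trans (hle.trans hhalf.ge)
    exact ⟨g', ⟨hne, ⟨F, hF⟩, hsample, by linarith⟩, h1⟩
  refine ⟨hleast, ⟨fun h => ?_, fun h g' ⟨hne, hg', hsample, hle⟩ => ?_⟩, halias, fun F f hf => ?_⟩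
  · by_contra hcon
    obtain ⟨g', hg', -⟩ := halias (not_lt.1 hcon)
    exact h g' hg'
  -- Spaces attaining both minima are used, so that both largest frequencies are below `π / Ts`.
  · obtain ⟨F, ⟨f, rfl⟩, hF⟩ := hleast.1
    obtain ⟨F', ⟨f', rfl⟩, hF'⟩ := (isLeast_minFreq hg').1
    rw [hiff, hF] at h
    refine hne (eq_of_forall_sample_eq hT0 ?_ h fun k => by exact_mod_cast hsample k)
    exact hF' ▸ (hle.trans_lt (hF ▸ h))
  · rw [hiff, F.isPrincipalLog_smul_L_iff hTs]
    refine ⟨Iff.rfl, fun h => ?_⟩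
    have hlog := (F.isPrincipalLog_smul_L_iff hTs).2 h
    exact ⟨⟨_, hlog, fun B hB => hB.unique hlog⟩, hlog.principalLog_eq, fun τ => by
      rw [← hf, F.sig_eq_exp_principalLog hTs h]⟩
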